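/- **Setting.** Let $d\in\{2,3\}$, $k\ge 2$, and let $\Omega\subset\mathbb R^d$ be a bounded domain (for instance a polygonal or polyhedral one). $H^m(U)$ is the Sobolev space of functions whose weak derivatives up to order $m$ lie in $L^2(U)$, with seminorm $|v|_{m,U}^2=\int_U|D^mv|^2$ and norm $\|v\|_{m,U}^2=\sum_{n\le m}|v|_{n,U}^2$ (the index $U$ is dropped for $U=\Omega$); $H^1_0$ is the closure of $C_c^\infty$ in $H^1$, and $H^{\rm div}(\Omega)=\{v\in L^2(\Omega)^d:\nabla\cdot v\in L^2(\Omega)\}$. Let $(\cdot,\cdot)$ be the $L^2(\Omega)$ scalar product, $\varepsilon(v)$ the symmetric gradient, $a(u,v)=2\mu(\varepsilon(u),\varepsilon(v))$ with $\mu>0$, and $b(q,v)=(q,\nabla\cdot v)$. For $f\in L^2(\Omega;\mathbb R^d)$ let $(u,p)\in H^{k+1}(\Omega)^d\times H^k(\Omega)$ solve the incompressible problem $$-2\mu\nabla\cdot\varepsilon(u)-\nabla p=f,\qquad \nabla\cdot u=0\quad\text{in }\Omega,\qquad u\in H^1_0(\Omega)^d .$$ Let $\mathcal T_h$ be a finite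 decomposition of $\Omega$ (up to a null set) into disjoint open elements $T$ with diameters $h_T$, and $h=\max_T h_T$. Let $V_h\subset H^1_0(\Omega;\mathbb R^d)$ and $Q_h\subset L^2(\Omega)$ be finite-dimensional subspaces, $\widetilde Q_h\subset L^2(\Omega;\mathbb R^d)$ a closed subspace, and $\pi^{\rm div}:V_h\to H^{\rm div}(\Omega)$ a linear operator. Let $(u_h,p_h)\in V_h\times Q_h$ solve the modified mixed scheme $$a(u_h,v_h)+b(p_h,v_h)=(f,\pi^{\rm div}v_h)\quad\forall v_h\in V_h,\qquad b(q_h,u_h)=0\quad\forall q_h\in Q_h .$$ **Assumptions**, with constants $C,\beta>0$. 1. *Spaces.* Below, $N_{m,T}$ is one of the two local quantities $\|\cdot\|_{m,T}$ or $|\cdot|_{m,T}$. * There is $I_h$ with $I_hv\in V_h$ and $h_T^i\|I_hv-v\|_{i,T}\le C h_T^{k+1}N_{k+1,T}(v)$ for all $v\in H^{k+1}(\Omega;\mathbb R^d)\cap H^1_0(\Omega;\mathbb R^d)$, $T\in\mathcal T_h$, $i=0,1$. * The $L^2$-projection $\pi_{k-1}$ onto $Q_h$ satisfies $\|\pi_{k-1}q-q\|_{0,T}\le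 C h_T^k\|q\|_{k,T}$ for all $q\in H^k(\Omega)$ with $\int_\Omega q=0$ and all $T\in\mathcal T_h$. * Inf-sup stability: $\displaystyle\inf_{0\ne q_h\in Q_h}\ \sup_{0\ne v_h\in V_h}\frac{(q_h,\nabla\cdot v_h)}{\|q_h\|_0\,|v_h|_1}\ge\beta$. * The $L^2$-projection $\pi_{k-2}$ onto $\widetilde Q_h$ satisfies $\|\pi_{k-2}q-q\|_{0,T}\le C h_T^{k-1}N_{k-1,T}(q)$ for all $q\in H^{k-1}(\Omega;\mathbb R^d)$, $T\in\mathcal T_h$. 2. *Reconstruction.* For all $v_h\in V_h$: * $b(q_h,\pi^{\rm div}v_h)=b(q_h,v_h)$ for all $q_h\in Q_h$; * if $b(q_h,v_h)=0$ for all $q_h\in Q_h$, then $\nabla\cdot\pi^{\rm div}v_h=0$; * $\pi^{\rm div}v_h\cdot n=0$ on $\partial\Omega$, in the sense that $(\pi^{\rm div}v_h,\nabla\varphi)+(\nabla\cdot\pi^{\rm div}v_h,\varphi)=0$ for all $\varphi\in H^1(\Omega)$; * $(v_h-\pi^{\rm div}v_h,q)=0$ for all $q\in\widetilde Q_h$;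 * $\|\pi^{\rm div}v_h-v_h\|_{0,T}\le C h_T^m|v_h|_{m,T}$ for $T\in\mathcal T_h$, $m=0,1$. **Theorem.** There is a constant $c>0$ that depends only on $d$, $k$, $\Omega$, $C$ and $\beta$ (in particular not on $\mathcal T_h$, the discrete spaces, $\pi^{\rm div}$, $\mu$, $f$, $u$ or $p$) such that the following holds. * If the assumptions hold with the seminorms $N_{m,T}=|\cdot|_{m,T}$, then $$|u-u_h|_1^2\le c\sum_{T\in\mathcal T_h}h_T^{2k}|u|_{k+1,T}^2\le c\,h^{2k}\|u\|_{k+1}^2 .$$ * If the assumptions hold with the full norms $N_{m,T}=\|\cdot\|_{m,T}$, then $$|u-u_h|_1^2\le c\sum_{T\in\mathcal T_h}h_T^{2k}\|u\|_{k+1,T}^2\le c\,h^{2k}\|u\|_{k+1}^2 .$$ -/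

import Mathlib

open MeasureTheory Set
open scoped ContDiff

namespace MixedElasticity

noncomputable section

/-- Euclidean space `ℝ^d`. -/
abbrev E (d : ℕ) : Type := EuclideanSpace ℝ (Fin d)

/-- The Hilbert space `L²(Ω; F)`. -/
abbrev L2 {d : ℕ} (Ω : Set (E d)) (F : Type) [NormedAddCommGroup F] : Type :=
  Lp F 2 (volume.restrict Ω)

section Sobolev

variable {d : ℕ} {F : Type} [NormedAddCommGroup F] [NormedSpace ℝ F]

/-- `φ ∈ C_c^∞(U; F)`. -/
def IsTestFun (U : Set (E d)) (φ : E d → F) : Prop :=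
  ContDiff ℝ ∞ φ ∧ HasCompactSupport φ ∧ tsupport φ ⊆ U

/-- The classical partial derivative `∂_{α 0} ⋯ ∂_{α (n-1)} φ` of order `n`. -/
def partialDeriv {n : ℕ} (α : Fin n → Fin d) (φ : E d → ℝ) (x : E d) : ℝ :=
  iteratedFDeriv ℝ n φ x fun j => EuclideanSpace.single (α j) (1 : ℝ)

/-- `g` is the weak derivative `∂_{α 0} ⋯ ∂_{α (n-1)} f` on the open set `U`. -/
def IsWeakDeriv (U : Set (E d)) {n : ℕ} (α : Fin n → Fin d) (f g : E d → F) : Prop :=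
  ∀ φ : E d → ℝ, IsTestFun U φ →
    ∫ x in U, partialDeriv α φ x • f x = (-1 : ℝ) ^ n • ∫ x in U, φ x • g x

open Classical in
/-- The weak derivative of `f` on `U`, when there is one in `L²(U)` (it is then unique up to null
sets). -/
def weakDeriv (U : Set (E d)) {n : ℕ} (α : Fin n → Fin d) (f : E d → F) : E d → F :=
  if h : ∃ g : E d → F, MemLp g 2 (volume.restrict U) ∧ IsWeakDeriv U α f g then h.choose else 0

/-- The weak partial derivative `∂_i f` on `U`. -/
def weakPartial (U : Set (E d)) (i : Fin d) (f : E d → F) : E d → F :=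
  weakDeriv U (fun _ : Fin 1 => i) f

/-- `f ∈ H^m(U; F)`: all weak derivatives of order at most `m` exist in `L²(U; F)`. -/
def MemH (m : ℕ) (U : Set (E d)) (f : E d → F) : Prop :=
  MemLp f 2 (volume.restrict U) ∧
    ∀ n ≤ m, ∀ α : Fin n → Fin d,
      ∃ g : E d → F, MemLp g 2 (volume.restrict U) ∧ IsWeakDeriv U α f g

/-- The seminorm `|f|_{m,U} = (∫_U |D^m f|²)^{1/2}` of `H^m(U; F)`; for `m = 0` it is the norm of
`L²(U; F)`. -/
def hSeminorm (m : ℕ) (U : Set (E d)) (f : E d → F) : ℝ :=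
  √(∑ α : Fin m → Fin d, ∫ x in U, ‖weakDeriv U α f x‖ ^ 2)

/-- The norm `‖f‖_{m,U}` of `H^m(U; F)`. -/
def hNorm (m : ℕ) (U : Set (E d)) (f : E d → F) : ℝ :=
  √(∑ n ∈ Finset.range (m + 1), hSeminorm n U f ^ 2)

/-- `f ∈ H^1_0(U; F)`, the closure of `C_c^∞(U; F)` in `H^1(U; F)`. -/
def MemH10 (U : Set (E d)) (f : E d → F) : Prop :=
  MemH 1 U f ∧ ∀ ε > 0, ∃ φ : E d → F, IsTestFun U φ ∧ hNorm 1 U (fun x => f x - φ x) < ε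

end Sobolev

section VectorFields

variable {d : ℕ}

/-- `g` is the weak divergence of `v` on `U`. -/
def IsWeakDiv (U : Set (E d)) (v : E d → E d) (g : E d → ℝ) : Prop :=
  ∀ φ : E d → ℝ, IsTestFun U φ → ∫ x in U, fderiv ℝ φ x (v x) = -∫ x in U, φ x * g x

/-- `v ∈ H^div(U)`: `v ∈ L²(U)^d` has a weak divergence in `L²(U)`. -/
def MemHdiv (U : Set (E d)) (v : E d → E d) : Prop :=
  MemLp v 2 (volume.restrict U) ∧
    ∃ g : E d → ℝ, MemLp g 2 (volume.restrict U) ∧ IsWeakDiv U v g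

open Classical in
/-- The divergence `∇ · v ∈ L²(U)` of `v ∈ H^div(U)`. -/
def divergence (U : Set (E d)) (v : E d → E d) : E d → ℝ :=
  if h : ∃ g : E d → ℝ, MemLp g 2 (volume.restrict U) ∧ IsWeakDiv U v g then h.choose else 0

/-- `v · n = 0` on `∂U` for `v ∈ H^div(U)`: the functional
`φ ↦ ∫_U v · ∇φ + ∫_U (∇ · v) φ`, which is the normal trace of `v`, vanishes on `H^1(U)`. -/
def NormalTraceZero (U : Set (E d)) (v : E d → E d) : Prop :=
  ∀ φ : E d → ℝ, MemH 1 U φ →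
    (∫ x in U, ∑ i, v x i * weakPartial U i φ x) + ∫ x in U, divergence U v x * φ x = 0

/-- The entry `ε(v)_{ij} = (∂_i v_j + ∂_j v_i) / 2` of the symmetric gradient. -/
def strain (U : Set (E d)) (v : E d → E d) (i j : Fin d) (x : E d) : ℝ :=
  (weakPartial U i v x j + weakPartial U j v x i) / 2

/-- `a(u, v) = 2 μ (ε(u), ε(v))`. -/
def aForm (Ω : Set (E d)) (μ : ℝ) (u v : E d → E d) : ℝ :=
  2 * μ * ∫ x in Ω, ∑ i, ∑ j, strain Ω u i j x * strain Ω v i j x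

/-- `b(q, v) = (q, ∇ · v)`. -/
def bForm (Ω : Set (E d)) (q : E d → ℝ) (v : E d → E d) : ℝ :=
  ∫ x in Ω, q x * divergence Ω v x

end VectorFields

/-- A decomposition of `Ω` into finitely many open elements. -/
structure Mesh {d : ℕ} (Ω : Set (E d)) where
  elems : Finset (Set (E d))
  isOpen : ∀ T ∈ elems, IsOpen T
  nonempty : ∀ T ∈ elems, T.Nonempty
  subset : ∀ T ∈ elems, T ⊆ Ω
  disjoint : (elems : Set (Set (E d))).PairwiseDisjoint id
  covers : volume (Ω \ ⋃ T ∈ elems, T) = 0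

/-- The mesh size `h`, the largest of the element diameters `h_T`. -/
def Mesh.size {d : ℕ} {Ω : Set (E d)} (M : Mesh Ω) : ℝ :=
  ⨆ T : M.elems, Metric.diam (T : Set (E d))

section Discretization

variable {d : ℕ} {Ω : Set (E d)}

/-- The inf-sup condition
`inf_{q ∈ Q_h} sup_{v ∈ V_h} (q, ∇ · v) / (‖q‖_0 |v|_1) ≥ β` (nonzero `q` and `v`). -/
def InfSup (Vh : Submodule ℝ (L2 Ω (E d))) (Qh : Submodule ℝ (L2 Ω ℝ)) (β : ℝ) : Prop :=
  (β : EReal) ≤ ⨅ q : {q : L2 Ω ℝ // q ∈ Qh ∧ q ≠ 0},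
    ⨆ v : {v : L2 Ω (E d) // v ∈ Vh ∧ v ≠ 0},
      ((bForm Ω q.1 v.1 / (‖q.1‖ * hSeminorm 1 Ω v.1) : ℝ) : EReal)

/-- The assumptions on the spaces `V_h ⊆ H^1_0(Ω; ℝ^d)`, `Q_h ⊆ L²(Ω)` and
`Qt ⊆ L²(Ω; ℝ^d)`: interpolation estimate for `V_h`, estimates for the `L²`-projections onto `Q_h`
and `Qt`, all with constant `C`, and inf-sup stability. The argument `N` is the local quantity on
the right of the estimates for `V_h` and `Qt`: `hNorm` or `hSeminorm`. -/
structure SpaceAssumption (k : ℕ) (C β : ℝ) (N : ℕ → Set (E d) → (E d → E d) → ℝ) (M : Mesh Ω)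
    (Vh : Submodule ℝ (L2 Ω (E d))) (Qh : Submodule ℝ (L2 Ω ℝ)) [Qh.HasOrthogonalProjection]
    (Qt : Submodule ℝ (L2 Ω (E d))) [Qt.HasOrthogonalProjection] : Prop where
  conforming : ∀ v ∈ Vh, MemH10 Ω v
  interpolation : ∃ I : L2 Ω (E d) → L2 Ω (E d),
    ∀ v : L2 Ω (E d), MemH (k + 1) Ω v → MemH10 Ω v →
      I v ∈ Vh ∧ ∀ T ∈ M.elems, ∀ i ≤ 1,
        Metric.diam T ^ i * hNorm i T (I v - v) ≤ C * Metric.diam T ^ (k + 1) * N (k + 1) T v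
  projection_Qh : ∀ q : L2 Ω ℝ, MemH k Ω q → ∫ x in Ω, q x = 0 → ∀ T ∈ M.elems,
    hNorm 0 T (Qh.starProjection q - q) ≤ C * Metric.diam T ^ k * hNorm k T q
  infSup : InfSup Vh Qh β
  projection_Qt : ∀ q : L2 Ω (E d), MemH (k - 1) Ω q → ∀ T ∈ M.elems,
    hNorm 0 T (Qt.starProjection q - q) ≤ C * Metric.diam T ^ (k - 1) * N (k - 1) T q

/-- The assumptions on the reconstruction operator `π^div : V_h → H^div(Ω)`. -/
structure ReconstructionAssumption (C : ℝ) (M : Mesh Ω)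
    (Vh : Submodule ℝ (L2 Ω (E d))) (Qh : Submodule ℝ (L2 Ω ℝ)) (Qt : Submodule ℝ (L2 Ω (E d)))
    (recon : Vh →ₗ[ℝ] L2 Ω (E d)) : Prop where
  memHdiv : ∀ v : Vh, MemHdiv Ω (recon v)
  commuting : ∀ v : Vh, ∀ q ∈ Qh, bForm Ω q (recon v) = bForm Ω q v.1
  divFree : ∀ v : Vh, (∀ q ∈ Qh, bForm Ω q v.1 = 0) →
    divergence Ω (recon v) =ᵐ[volume.restrict Ω] 0
  normalTrace : ∀ v : Vh, NormalTraceZero Ω (recon v)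
  orthogonality : ∀ v : Vh, ∀ q ∈ Qt, inner ℝ (v.1 - recon v) q = 0
  approximation : ∀ v : Vh, ∀ T ∈ M.elems, ∀ m ≤ 1,
    hNorm 0 T (recon v - v.1) ≤ C * Metric.diam T ^ m * hSeminorm m T v.1

/-- `(u, p)` solves `-2 μ ∇ · ε(u) - ∇p = f`, `∇ · u = 0` in `Ω` and `u = 0` on `∂Ω`; the
equations hold almost everywhere, with weak derivatives. -/
structure IsSolution (Ω : Set (E d)) (μ : ℝ) (f u : L2 Ω (E d)) (p : L2 Ω ℝ) : Prop where
  momentum : ∀ᵐ x ∂volume.restrict Ω, ∀ i,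
    -2 * μ * (∑ j, weakPartial Ω j (strain Ω u i j) x) - weakPartial Ω i p x = f x i
  incompressible : divergence Ω u =ᵐ[volume.restrict Ω] 0
  boundary : MemH10 Ω u

/-- `(u_h, p_h) ∈ V_h × Q_h` solves the modified discrete problem with `λ = ∞`:
`a(u_h, v_h) + b(p_h, v_h) = (f, π^div v_h)` and `b(q_h, u_h) = 0`. -/
structure IsDiscreteSolution (μ : ℝ) (f : L2 Ω (E d)) (Vh : Submodule ℝ (L2 Ω (E d)))
    (Qh : Submodule ℝ (L2 Ω ℝ)) (recon : Vh →ₗ[ℝ] L2 Ω (E d)) (uh : L2 Ω (E d)) (ph : L2 Ω ℝ) :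
    Prop where
  mem_Vh : uh ∈ Vh
  mem_Qh : ph ∈ Qh
  momentum : ∀ v : Vh, aForm Ω μ uh v.1 + bForm Ω ph v.1 = inner ℝ f (recon v)
  incompressible : ∀ q ∈ Qh, bForm Ω q uh = 0

end Discretization

end

end MixedElasticity

namespace MixedElasticity

noncomputable section

/-! ### Closure properties of test functions -/

section TestFunctions

variable {d : ℕ} {F : Type} [NormedAddCommGroup F] [NormedSpace ℝ F] {U T : Set (E d)}

/-! The argument is an energy estimate inside the discrete kernel, the fields of `V_h` whose
divergence is orthogonal to `Q_h`. Write q = ∇·ε(u), so that f = -2μq - ∇p. For e in the discrete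
kernel, π^div e is exactly divergence free with zero normal trace, so ∇p is orthogonal to it and (f,
π^div e) = -2μ(q, π^div e) (`IsSolution.inner_force`). The discrete pressure vanishes against e as
well. Both sides then carry the factor 2μ, which cancels: this is why neither the pressure nor μ
enters the bound.

Let z be a discrete kernel element close to u and e = u_h - z. Since (ε(u), ε(e)) = -(q, e),
subtraction gives ‖ε(e)‖² = (q, e - π^div e) + (ε(u - z), ε(e)). Korn's inequality
(`MemH10.norm_gradField_sq_le`) bounds |e|_1² by twice the left side.

The consistency term (q, e - π^div e) is of full order (`inner_sub_recon_le`): orthogonality to the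
reduced space allows its projection to be subtracted from q, gaining h_T^{k-1}, and the
reconstruction error gains the missing h_T; q costs two derivatives of u. The approximation term is
handled by `exists_discrete_kernel_approx`: inf-sup stability makes the discrete kernel approximate
u as well as all of `V_h` does, up to a constant. `norm_gradField_error_le` assembles these bounds.

Gradients are treated as elements of the Hilbert space `MatrixField`, where the forms a and b become
inner products with the bounded operators `symField` and `traceField`. -/

theorem IsTestFun.mono {φ : E d → F} (h : IsTestFun T φ) (hTU : T ⊆ U) : IsTestFun U φ :=
  ⟨h.1, h.2.1, h.2.2.trans hTU⟩

theorem IsTestFun.memLp {φ : E d → F} (h : IsTestFun U φ) (p : ENNReal) (ν : Measure (E d))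
    [IsFiniteMeasureOnCompacts ν] : MemLp φ p ν :=
  h.1.continuous.memLp_of_hasCompactSupport h.2.1

theorem IsTestFun.clm_comp {G : Type} [NormedAddCommGroup G] [NormedSpace ℝ G] {φ : E d → F}
    (h : IsTestFun U φ) (A : F →L[ℝ] G) : IsTestFun U (fun x => A (φ x)) :=
  ⟨A.contDiff.comp h.1, h.2.1.comp_left A.map_zero,
    (tsupport_comp_subset A.map_zero φ).trans h.2.2⟩

theorem IsTestFun.eq_zero {φ : E d → F} (h : IsTestFun U φ) {x : E d} (hx : x ∉ U) : φ x = 0 :=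
  image_eq_zero_of_notMem_tsupport fun h' => hx (h.2.2 h')

theorem IsTestFun.fderiv_apply {φ : E d → F} (h : IsTestFun U φ) (v : E d) :
    IsTestFun U (fun x => fderiv ℝ φ x v) := by
  have h1 : IsTestFun U (fderiv ℝ φ) :=
    ⟨h.1.fderiv_right (by exact_mod_cast le_top), h.2.1.fderiv ℝ, (tsupport_fderiv_subset ℝ).trans h.2.2⟩
  exact h1.clm_comp (ContinuousLinearMap.apply ℝ F v)

theorem IsTestFun.partialDeriv {φ : E d → ℝ} (h : IsTestFun U φ) {n : ℕ} (α : Fin n → Fin d) :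
    IsTestFun U (partialDeriv α φ) := by
  have h1 : IsTestFun U (iteratedFDeriv ℝ n φ) :=
    ⟨h.1.iteratedFDeriv_right (by exact_mod_cast le_top), h.2.1.iteratedFDeriv n,
      (tsupport_iteratedFDeriv_subset n).trans h.2.2⟩
  exact h1.clm_comp (ContinuousMultilinearMap.apply ℝ (fun _ : Fin n => E d) ℝ
    fun j => EuclideanSpace.single (α j) (1 : ℝ))

theorem partialDeriv_zero (α : Fin 0 → Fin d) (φ : E d → ℝ) : partialDeriv α φ = φ := by
  funext x
  simp [partialDeriv]

theorem partialDeriv_one (α : Fin 1 → Fin d) (φ : E d → ℝ) (x : E d) :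
    partialDeriv α φ x = fderiv ℝ φ x (EuclideanSpace.single (α 0) 1) := by
  simp [partialDeriv]

theorem partialDeriv_cons {φ : E d → ℝ} (h : ContDiff ℝ ∞ φ) {n : ℕ} (i : Fin d)
    (α : Fin n → Fin d) (x : E d) :
    partialDeriv (fun _ : Fin 1 => i) (partialDeriv α φ) x = partialDeriv (Fin.cons i α) φ x := by
  rw [partialDeriv_one]
  have h1 : DifferentiableAt ℝ (iteratedFDeriv ℝ n φ) x :=
    ((h.iteratedFDeriv_right (m := 1) (by exact_mod_cast le_top)).differentiable (by simp)) x
  set A := ContinuousMultilinearMap.apply ℝ (fun _ : Fin n => E d) ℝ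
    fun j => EuclideanSpace.single (α j) (1 : ℝ) with hA
  have h2 : partialDeriv α φ = fun y => A (iteratedFDeriv ℝ n φ y) := rfl
  have h3 := (A.hasFDerivAt.comp x h1.hasFDerivAt).fderiv
  rw [h2]
  change fderiv ℝ (A ∘ iteratedFDeriv ℝ n φ) x _ = _
  rw [h3, partialDeriv, iteratedFDeriv_succ_apply_left]
  rfl

theorem IsTestFun.integrable_smul {φ : E d → ℝ} (h : IsTestFun U φ) {ν : Measure (E d)}
    [IsFiniteMeasureOnCompacts ν] {f : E d → F} (hf : MemLp f 2 ν) :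
    Integrable (fun x => φ x • f x) ν :=
  memLp_one_iff_integrable.1 (hf.smul (h.memLp 2 ν))

end TestFunctions

/-! ### Calculus of weak derivatives -/

section WeakDerivatives

variable {d : ℕ} {F G : Type} [NormedAddCommGroup F] [NormedSpace ℝ F]
  [NormedAddCommGroup G] [NormedSpace ℝ G] {U T : Set (E d)} {n : ℕ} {α : Fin n → Fin d}
  {f f' g g' : E d → F}

/-- Two `L²` functions on an open set that agree when tested against `C_c^∞` agree a.e. -/
theorem ae_eq_of_forall_isTestFun [CompleteSpace F] (hU : IsOpen U)
    (hg : MemLp g 2 (volume.restrict U)) (hg' : MemLp g' 2 (volume.restrict U))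
    (h : ∀ φ : E d → ℝ, IsTestFun U φ → ∫ x in U, φ x • g x = ∫ x in U, φ x • g' x) :
    g =ᵐ[volume.restrict U] g' := by
  have hloc : LocallyIntegrableOn (fun x => g x - g' x) U volume := by
    rw [locallyIntegrableOn_iff hU.isLocallyClosed]
    intro K hKU hK
    have : IsFiniteMeasure (volume.restrict K) := ⟨by simpa using hK.measure_lt_top⟩
    have h2 : MemLp (fun x => g x - g' x) 2 (volume.restrict K) :=
      (hg.sub hg').mono_measure (Measure.restrict_mono hKU le_rfl)
    exact h2.integrable (by norm_num)
  have h0 := hU.ae_eq_zero_of_integral_contDiff_smul_eq_zero hloc fun φ h1 h2 h3 => by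
    have hφ : IsTestFun U φ := ⟨h1, h2, h3⟩
    rw [← setIntegral_eq_integral_of_forall_compl_eq_zero (s := U)
      (fun x hx => by rw [hφ.eq_zero hx, zero_smul])]
    simp_rw [smul_sub]
    rw [integral_sub (hφ.integrable_smul hg) (hφ.integrable_smul hg'), h φ hφ, sub_self]
  rw [Filter.EventuallyEq, ae_restrict_iff' hU.measurableSet]
  filter_upwards [h0] with x hx hxU
  exact sub_eq_zero.1 (hx hxU)

theorem IsWeakDeriv.ae_unique [CompleteSpace F] (hU : IsOpen U)
    (hg : MemLp g 2 (volume.restrict U)) (hg' : MemLp g' 2 (volume.restrict U))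
    (h : IsWeakDeriv U α f g) (h' : IsWeakDeriv U α f g') : g =ᵐ[volume.restrict U] g' :=
  ae_eq_of_forall_isTestFun hU hg hg' fun φ hφ => by
    have := (h φ hφ).symm.trans (h' φ hφ)
    exact smul_right_injective F (pow_ne_zero n (by norm_num : (-1 : ℝ) ≠ 0)) this

theorem IsWeakDeriv.congr (h : IsWeakDeriv U α f g) (hf : f =ᵐ[volume.restrict U] f')
    (hg : g =ᵐ[volume.restrict U] g') : IsWeakDeriv U α f' g' := by
  intro φ hφ
  have h1 : ∫ x in U, MixedElasticity.partialDeriv α φ x • f' x =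
      ∫ x in U, MixedElasticity.partialDeriv α φ x • f x :=
    integral_congr_ae (hf.mono fun x hx => by simp only [hx])
  have h2 : ∫ x in U, φ x • g' x = ∫ x in U, φ x • g x :=
    integral_congr_ae (hg.mono fun x hx => by simp only [hx])
  rw [h1, h2, h φ hφ]

/-- The result is a true equality, not one almost everywhere: both choices are made from the same
predicate. -/
theorem weakDeriv_congr (α : Fin n → Fin d) (hf : f =ᵐ[volume.restrict U] f') :
    weakDeriv U α f = weakDeriv U α f' := by
  have : IsWeakDeriv U α f = IsWeakDeriv U α f' := by
    funext g
    exact propext ⟨fun h => h.congr hf .rfl, fun h => h.congr hf.symm .rfl⟩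
  unfold weakDeriv
  rw [this]

theorem memLp_weakDeriv (U : Set (E d)) (α : Fin n → Fin d) (f : E d → F) :
    MemLp (weakDeriv U α f) 2 (volume.restrict U) := by
  unfold weakDeriv
  split_ifs with h
  · exact h.choose_spec.1
  · exact MemLp.zero

theorem isWeakDeriv_weakDeriv
    (h : ∃ g : E d → F, MemLp g 2 (volume.restrict U) ∧ IsWeakDeriv U α f g) :
    IsWeakDeriv U α f (weakDeriv U α f) := by
  unfold weakDeriv
  rw [dif_pos h]
  exact h.choose_spec.2

/-- `weakDeriv` is an arbitrary choice, so each calculus rule is proved for one convenient candidate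
and transferred to the chosen derivative by uniqueness. -/
theorem IsWeakDeriv.weakDeriv_ae_eq [CompleteSpace F] (hU : IsOpen U)
    (hg : MemLp g 2 (volume.restrict U)) (h : IsWeakDeriv U α f g) :
    weakDeriv U α f =ᵐ[volume.restrict U] g :=
  (isWeakDeriv_weakDeriv ⟨g, hg, h⟩).ae_unique hU (memLp_weakDeriv U α f) hg h

theorem IsWeakDeriv.add (hf : MemLp f 2 (volume.restrict U)) (hf' : MemLp f' 2 (volume.restrict U))
    (hg : MemLp g 2 (volume.restrict U)) (hg' : MemLp g' 2 (volume.restrict U))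
    (h : IsWeakDeriv U α f g) (h' : IsWeakDeriv U α f' g') :
    IsWeakDeriv U α (fun x => f x + f' x) (fun x => g x + g' x) := by
  intro φ hφ
  simp_rw [smul_add]
  rw [integral_add ((hφ.partialDeriv α).integrable_smul hf)
    ((hφ.partialDeriv α).integrable_smul hf'), integral_add (hφ.integrable_smul hg)
    (hφ.integrable_smul hg'), h φ hφ, h' φ hφ, smul_add]

theorem IsWeakDeriv.clm_comp [CompleteSpace F] [CompleteSpace G] (A : F →L[ℝ] G)
    (hf : MemLp f 2 (volume.restrict U)) (hg : MemLp g 2 (volume.restrict U))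
    (h : IsWeakDeriv U α f g) : IsWeakDeriv U α (fun x => A (f x)) (fun x => A (g x)) := by
  intro φ hφ
  simp_rw [← map_smul]
  rw [A.integral_comp_comm ((hφ.partialDeriv α).integrable_smul hf),
    A.integral_comp_comm (hφ.integrable_smul hg), h φ hφ, map_smul]

theorem isWeakDeriv_zero (U : Set (E d)) (α : Fin n → Fin d) :
    IsWeakDeriv U α (fun _ => (0 : F)) fun _ => 0 := by
  intro φ _
  simp

theorem IsWeakDeriv.sum {ι : Type} (s : Finset ι) {f g : ι → E d → F}
    (hf : ∀ i ∈ s, MemLp (f i) 2 (volume.restrict U))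
    (hg : ∀ i ∈ s, MemLp (g i) 2 (volume.restrict U))
    (h : ∀ i ∈ s, IsWeakDeriv U α (f i) (g i)) :
    IsWeakDeriv U α (fun x => ∑ i ∈ s, f i x) (fun x => ∑ i ∈ s, g i x) := by
  classical
  induction s using Finset.induction_on with
  | empty => simpa using isWeakDeriv_zero U α
  | insert a s ha ih =>
    simp only [Finset.forall_mem_insert] at hf hg h
    simp_rw [Finset.sum_insert ha]
    exact h.1.add hf.1 (memLp_finsetSum s hf.2) hg.1 (memLp_finsetSum s hg.2)
      (ih hf.2 hg.2 h.2)

theorem setIntegral_eq_of_isTestFun {φ : E d → ℝ} (hφ : IsTestFun T φ) (hU : IsOpen U)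
    (hTU : T ⊆ U) (f : E d → F) : ∫ x in U, φ x • f x = ∫ x in T, φ x • f x :=
  setIntegral_eq_of_subset_of_forall_sdiff_eq_zero hU.measurableSet hTU
    fun x hx => by rw [hφ.eq_zero hx.2, zero_smul]

theorem IsWeakDeriv.restrict (hU : IsOpen U) (hTU : T ⊆ U) (h : IsWeakDeriv U α f g) :
    IsWeakDeriv T α f g := by
  intro φ hφ
  rw [← setIntegral_eq_of_isTestFun (hφ.partialDeriv α) hU hTU,
    ← setIntegral_eq_of_isTestFun hφ hU hTU, h φ (hφ.mono hTU)]

theorem MemH.restrict {m : ℕ} (hU : IsOpen U) (hTU : T ⊆ U) (h : MemH m U f) : MemH m T f := by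
  have hm := Measure.restrict_mono (μ := (volume : Measure (E d))) hTU le_rfl
  refine ⟨h.1.mono_measure hm, fun n hn α => ?_⟩
  obtain ⟨g, hg, hfg⟩ := h.2 n hn α
  exact ⟨g, hg.mono_measure hm, hfg.restrict hU hTU⟩

theorem weakDeriv_restrict [CompleteSpace F] (hU : IsOpen U) (hT : IsOpen T) (hTU : T ⊆ U)
    (h : ∃ g : E d → F, MemLp g 2 (volume.restrict U) ∧ IsWeakDeriv U α f g) :
    weakDeriv T α f =ᵐ[volume.restrict T] weakDeriv U α f :=
  ((isWeakDeriv_weakDeriv h).restrict hU hTU).weakDeriv_ae_eq hT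
    ((memLp_weakDeriv U α f).mono_measure (Measure.restrict_mono hTU le_rfl))

theorem MemH.mono {m m' : ℕ} (h : MemH m U f) (hm : m' ≤ m) : MemH m' U f :=
  ⟨h.1, fun n hn => h.2 n (hn.trans hm)⟩

theorem MemH.congr {m : ℕ} (h : MemH m U f) (hf : f =ᵐ[volume.restrict U] f') : MemH m U f' :=
  ⟨(memLp_congr_ae hf).1 h.1, fun n hn α =>
    let ⟨g, hg, hfg⟩ := h.2 n hn α
    ⟨g, hg, hfg.congr hf .rfl⟩⟩

theorem MemH.add {m : ℕ} (h : MemH m U f) (h' : MemH m U f') :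
    MemH m U fun x => f x + f' x := by
  refine ⟨h.1.add h'.1, fun n hn α => ?_⟩
  obtain ⟨g, hg, hfg⟩ := h.2 n hn α
  obtain ⟨g', hg', hfg'⟩ := h'.2 n hn α
  exact ⟨_, hg.add hg', hfg.add h.1 h'.1 hg hg' hfg'⟩

theorem MemH.clm_comp [CompleteSpace F] [CompleteSpace G] {m : ℕ} (A : F →L[ℝ] G)
    (h : MemH m U f) : MemH m U fun x => A (f x) := by
  refine ⟨A.comp_memLp' h.1, fun n hn α => ?_⟩
  obtain ⟨g, hg, hfg⟩ := h.2 n hn α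
  exact ⟨_, A.comp_memLp' hg, hfg.clm_comp A h.1 hg⟩

theorem MemH.sum {ι : Type} {m : ℕ} (s : Finset ι) {f : ι → E d → F}
    (h : ∀ i ∈ s, MemH m U (f i)) : MemH m U fun x => ∑ i ∈ s, f i x := by
  refine ⟨memLp_finsetSum s fun i hi => (h i hi).1, fun n hn α => ?_⟩
  exact ⟨_, memLp_finsetSum s fun i _ => memLp_weakDeriv U α (f i),
    IsWeakDeriv.sum s (fun i hi => (h i hi).1) (fun i _ => memLp_weakDeriv U α (f i))
      fun i hi => isWeakDeriv_weakDeriv ((h i hi).2 n hn α)⟩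

theorem MemH.weakDeriv_add [CompleteSpace F] {m : ℕ} (hU : IsOpen U) (h : MemH m U f)
    (h' : MemH m U f') (hn : n ≤ m) (α : Fin n → Fin d) :
    weakDeriv U α (fun x => f x + f' x) =ᵐ[volume.restrict U]
      fun x => weakDeriv U α f x + weakDeriv U α f' x :=
  ((isWeakDeriv_weakDeriv (h.2 n hn α)).add h.1 h'.1 (memLp_weakDeriv U α f)
    (memLp_weakDeriv U α f') (isWeakDeriv_weakDeriv (h'.2 n hn α))).weakDeriv_ae_eq hU
    ((memLp_weakDeriv U α f).add (memLp_weakDeriv U α f'))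

theorem MemH.weakDeriv_clm_comp [CompleteSpace F] [CompleteSpace G] {m : ℕ} (hU : IsOpen U)
    (A : F →L[ℝ] G) (h : MemH m U f) (hn : n ≤ m) (α : Fin n → Fin d) :
    weakDeriv U α (fun x => A (f x)) =ᵐ[volume.restrict U] fun x => A (weakDeriv U α f x) :=
  ((isWeakDeriv_weakDeriv (h.2 n hn α)).clm_comp A h.1
    (memLp_weakDeriv U α f)).weakDeriv_ae_eq hU (A.comp_memLp' (memLp_weakDeriv U α f))

theorem MemH.weakDeriv_sum [CompleteSpace F] {ι : Type} {m : ℕ} (hU : IsOpen U) (s : Finset ι)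
    {f : ι → E d → F} (h : ∀ i ∈ s, MemH m U (f i)) (hn : n ≤ m) (α : Fin n → Fin d) :
    weakDeriv U α (fun x => ∑ i ∈ s, f i x) =ᵐ[volume.restrict U]
      fun x => ∑ i ∈ s, weakDeriv U α (f i) x :=
  (IsWeakDeriv.sum s (fun i hi => (h i hi).1) (fun i _ => memLp_weakDeriv U α (f i))
      fun i hi => isWeakDeriv_weakDeriv ((h i hi).2 n hn α)).weakDeriv_ae_eq hU
    (memLp_finsetSum s fun i _ => memLp_weakDeriv U α (f i))

theorem weakDeriv_zero_ae_eq [CompleteSpace F] (hU : IsOpen U) (α : Fin 0 → Fin d)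
    (hf : MemLp f 2 (volume.restrict U)) : weakDeriv U α f =ᵐ[volume.restrict U] f :=
  IsWeakDeriv.weakDeriv_ae_eq hU hf fun φ _ => by simp [partialDeriv_zero]

theorem memLp_weakPartial (U : Set (E d)) (i : Fin d) (f : E d → F) :
    MemLp (weakPartial U i f) 2 (volume.restrict U) :=
  memLp_weakDeriv U _ f

/-- Testing the first derivative against ∂_α φ produces the full derivative of φ; one sign then
cancels. This lets higher derivatives of f be read as derivatives of ∂_i f. -/
theorem IsWeakDeriv.of_cons {i : Fin d} (hg : IsWeakDeriv U (fun _ : Fin 1 => i) f g)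
    (h : IsWeakDeriv U (Fin.cons i α : Fin (n + 1) → Fin d) f g') : IsWeakDeriv U α g g' := by
  intro φ hφ
  have h1 := hg _ (hφ.partialDeriv α)
  have h2 := h φ hφ
  simp_rw [partialDeriv_cons hφ.1] at h1
  rw [h1, pow_one, pow_succ', mul_smul] at h2
  exact smul_right_injective F (by norm_num : (-1 : ℝ) ≠ 0) h2

theorem MemH.isWeakDeriv_weakPartial {m : ℕ} (h : MemH m U f) (hn : n + 1 ≤ m) (i : Fin d)
    (α : Fin n → Fin d) :
    IsWeakDeriv U α (weakPartial U i f)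
      (weakDeriv U (Fin.cons i α : Fin (n + 1) → Fin d) f) :=
  (isWeakDeriv_weakDeriv (h.2 1 (by omega) _)).of_cons (isWeakDeriv_weakDeriv (h.2 _ hn _))

theorem MemH.weakPartial {m : ℕ} (h : MemH (m + 1) U f) (i : Fin d) :
    MemH m U (weakPartial U i f) :=
  ⟨memLp_weakPartial U i f, fun _ hn α =>
    ⟨_, memLp_weakDeriv U _ f, h.isWeakDeriv_weakPartial (by omega) i α⟩⟩

theorem MemH.weakDeriv_weakPartial [CompleteSpace F] {m : ℕ} (hU : IsOpen U) (h : MemH m U f)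
    (hn : n + 1 ≤ m) (i : Fin d) (α : Fin n → Fin d) :
    weakDeriv U α (MixedElasticity.weakPartial U i f) =ᵐ[volume.restrict U]
      weakDeriv U (Fin.cons i α : Fin (n + 1) → Fin d) f :=
  (h.isWeakDeriv_weakPartial hn i α).weakDeriv_ae_eq hU (memLp_weakDeriv U _ f)

theorem IsTestFun.isWeakDeriv {φ : E d → F} (h : IsTestFun U φ) (i : Fin d) :
    IsWeakDeriv U (fun _ : Fin 1 => i) φ fun x => fderiv ℝ φ x (EuclideanSpace.single i 1) := by
  intro ψ hψ
  simp_rw [partialDeriv_one]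
  set e : E d := EuclideanSpace.single i 1
  rw [setIntegral_eq_integral_of_forall_compl_eq_zero
      (fun x hx => by rw [h.eq_zero hx, smul_zero]),
    setIntegral_eq_integral_of_forall_compl_eq_zero
      (fun x hx => by rw [hψ.eq_zero hx, zero_smul]),
    integral_smul_fderiv_eq_neg_fderiv_smul_of_integrable]
  · simp
  · exact (hψ.fderiv_apply e).integrable_smul (h.memLp 2 volume)
  · exact hψ.integrable_smul ((h.fderiv_apply e).memLp 2 volume)
  · exact hψ.integrable_smul (h.memLp 2 volume)
  · exact fun x _ => (hψ.1.differentiable (by simp)) x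
  · exact fun x _ => (h.1.differentiable (by simp)) x

theorem IsTestFun.memH {φ : E d → F} (h : IsTestFun U φ) : MemH 1 U φ := by
  refine ⟨h.memLp 2 _, fun n hn α => ?_⟩
  interval_cases n
  · exact ⟨φ, h.memLp 2 _, fun ψ _ => by simp [partialDeriv_zero]⟩
  · have : α = fun _ => α 0 := by
      funext j
      rw [Subsingleton.elim j 0]
    rw [this]
    exact ⟨_, (h.fderiv_apply _).memLp 2 _, h.isWeakDeriv (α 0)⟩

theorem IsTestFun.weakPartial_ae_eq [CompleteSpace F] (hU : IsOpen U) {φ : E d → F}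
    (h : IsTestFun U φ) (i : Fin d) : weakPartial U i φ =ᵐ[volume.restrict U]
      fun x => fderiv ℝ φ x (EuclideanSpace.single i 1) :=
  (h.isWeakDeriv i).weakDeriv_ae_eq hU ((h.fderiv_apply _).memLp 2 _)

end WeakDerivatives

/-! ### Sobolev seminorms under derivatives, linear maps and sums -/

section Seminorms

variable {d : ℕ} {F G : Type} [NormedAddCommGroup F] [NormedSpace ℝ F]
  [NormedAddCommGroup G] [NormedSpace ℝ G] {U T : Set (E d)} {m n : ℕ} {f f' : E d → F}

theorem integrable_norm_sq {H : Type} [NormedAddCommGroup H] {ν : Measure (E d)} {f : E d → H}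
    (hf : MemLp f 2 ν) : Integrable (fun x => ‖f x‖ ^ 2) ν :=
  (memLp_two_iff_integrable_sq_norm hf.1).1 hf

theorem hSeminorm_nonneg (m : ℕ) (U : Set (E d)) (f : E d → F) : 0 ≤ hSeminorm m U f :=
  Real.sqrt_nonneg _

theorem hNorm_nonneg (m : ℕ) (U : Set (E d)) (f : E d → F) : 0 ≤ hNorm m U f :=
  Real.sqrt_nonneg _

theorem hSeminorm_sq (m : ℕ) (U : Set (E d)) (f : E d → F) :
    hSeminorm m U f ^ 2 = ∑ α : Fin m → Fin d, ∫ x in U, ‖weakDeriv U α f x‖ ^ 2 :=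
  Real.sq_sqrt (Finset.sum_nonneg fun _ _ => integral_nonneg fun _ => by positivity)

theorem hNorm_sq (m : ℕ) (U : Set (E d)) (f : E d → F) :
    hNorm m U f ^ 2 = ∑ n ∈ Finset.range (m + 1), hSeminorm n U f ^ 2 :=
  Real.sq_sqrt (Finset.sum_nonneg fun _ _ => by positivity)

theorem hSeminorm_le_hNorm (hn : n ≤ m) (U : Set (E d)) (f : E d → F) :
    hSeminorm n U f ≤ hNorm m U f := by
  rw [← sq_le_sq₀ (hSeminorm_nonneg _ _ _) (hNorm_nonneg _ _ _), hNorm_sq]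
  exact Finset.single_le_sum (f := fun n => hSeminorm n U f ^ 2) (fun _ _ => by positivity)
    (Finset.mem_range.2 (by omega))

theorem hSeminorm_congr (m : ℕ) (hf : f =ᵐ[volume.restrict U] f') :
    hSeminorm m U f = hSeminorm m U f' := by
  simp only [hSeminorm, weakDeriv_congr _ hf]

theorem hNorm_congr (m : ℕ) (hf : f =ᵐ[volume.restrict U] f') :
    hNorm m U f = hNorm m U f' := by
  simp only [hNorm, hSeminorm_congr _ hf]

theorem hSeminorm_zero_sq [CompleteSpace F] (hU : IsOpen U) (hf : MemLp f 2 (volume.restrict U)) :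
    hSeminorm 0 U f ^ 2 = ∫ x in U, ‖f x‖ ^ 2 := by
  rw [hSeminorm_sq, Fintype.sum_unique]
  exact integral_congr_ae ((weakDeriv_zero_ae_eq hU default hf).mono fun x hx => by simp only [hx])

theorem hNorm_zero (U : Set (E d)) (f : E d → F) : hNorm 0 U f = hSeminorm 0 U f := by
  simp [hNorm, Real.sqrt_sq (hSeminorm_nonneg 0 U f)]

theorem hSeminorm_one_sq (U : Set (E d)) (f : E d → F) :
    hSeminorm 1 U f ^ 2 = ∑ i, ∫ x in U, ‖weakPartial U i f x‖ ^ 2 := by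
  rw [hSeminorm_sq]
  refine Fintype.sum_equiv (Equiv.funUnique (Fin 1) (Fin d)) _ _ fun α => ?_
  have : α = fun _ => α default := by
    funext j
    rw [Subsingleton.elim j default]
  conv_lhs => rw [this]
  rfl

theorem MemH.hSeminorm_sq_restrict [CompleteSpace F] (hU : IsOpen U) (hT : IsOpen T)
    (hTU : T ⊆ U) (h : MemH m U f) (hn : n ≤ m) :
    hSeminorm n T f ^ 2 = ∑ α : Fin n → Fin d, ∫ x in T, ‖weakDeriv U α f x‖ ^ 2 := by
  rw [hSeminorm_sq]
  exact Finset.sum_congr rfl fun α _ => integral_congr_ae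
    ((weakDeriv_restrict hU hT hTU (h.2 n hn α)).mono fun x hx => by simp only [hx])

theorem MemH.hSeminorm_weakPartial_le [CompleteSpace F] (hU : IsOpen U) (h : MemH m U f)
    (hn : n + 1 ≤ m) (i : Fin d) :
    hSeminorm n U (MixedElasticity.weakPartial U i f) ≤ hSeminorm (n + 1) U f := by
  classical
  rw [← sq_le_sq₀ (hSeminorm_nonneg _ _ _) (hSeminorm_nonneg _ _ _), hSeminorm_sq, hSeminorm_sq]
  have h1 : ∀ α : Fin n → Fin d,
      ∫ x in U, ‖weakDeriv U α (MixedElasticity.weakPartial U i f) x‖ ^ 2 =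
        ∫ x in U, ‖weakDeriv U (Fin.cons i α : Fin (n + 1) → Fin d) f x‖ ^ 2 := fun α =>
    integral_congr_ae ((h.weakDeriv_weakPartial hU hn i α).mono fun x hx => by simp only [hx])
  simp_rw [h1]
  -- The index tuples starting with i form a subset of all tuples of length n + 1, and the remaining
  -- terms are nonnegative.
  have hinj : Function.Injective fun α : Fin n → Fin d => (Fin.cons i α : Fin (n + 1) → Fin d) :=
    Fin.cons_right_injective (α := fun _ => Fin d) i
  rw [← Finset.sum_image (s := Finset.univ)
    (f := fun β : Fin (n + 1) → Fin d => ∫ x in U, ‖weakDeriv U β f x‖ ^ 2) hinj.injOn]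
  exact Finset.sum_le_sum_of_subset_of_nonneg (Finset.subset_univ _)
    fun _ _ _ => integral_nonneg fun _ => by positivity

theorem MemH.hSeminorm_clm_comp_le [CompleteSpace F] [CompleteSpace G] (hU : IsOpen U)
    (A : F →L[ℝ] G) (h : MemH m U f) (hn : n ≤ m) :
    hSeminorm n U (fun x => A (f x)) ^ 2 ≤ ‖A‖ ^ 2 * hSeminorm n U f ^ 2 := by
  rw [hSeminorm_sq, hSeminorm_sq, Finset.mul_sum]
  refine Finset.sum_le_sum fun α _ => ?_
  rw [← integral_const_mul]
  refine integral_mono_ae (integrable_norm_sq (memLp_weakDeriv U _ _))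
    ((integrable_norm_sq (memLp_weakDeriv U _ _)).const_mul _) ?_
  filter_upwards [h.weakDeriv_clm_comp hU A hn α] with x hx
  simp only [hx, ← mul_pow]
  gcongr
  exact A.le_opNorm _

theorem MemH.hSeminorm_sum_sq_le [CompleteSpace F] {ι : Type} (hU : IsOpen U) (s : Finset ι)
    {f : ι → E d → F} (h : ∀ i ∈ s, MemH m U (f i)) (hn : n ≤ m) :
    hSeminorm n U (fun x => ∑ i ∈ s, f i x) ^ 2 ≤ s.card * ∑ i ∈ s, hSeminorm n U (f i) ^ 2 := by
  simp_rw [hSeminorm_sq]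
  rw [Finset.sum_comm, Finset.mul_sum]
  refine Finset.sum_le_sum fun α _ => ?_
  have hint : ∀ i ∈ s, Integrable (fun x => ‖weakDeriv U α (f i) x‖ ^ 2) (volume.restrict U) :=
    fun i _ => (integrable_norm_sq (memLp_weakDeriv U _ _))
  rw [← integral_finsetSum _ hint, ← integral_const_mul]
  refine integral_mono_ae (integrable_norm_sq (memLp_weakDeriv U _ _))
    ((integrable_finsetSum _ hint).const_mul _) ?_
  filter_upwards [MemH.weakDeriv_sum hU s h hn α] with x hx
  simp only [hx]
  calc _ ≤ (∑ i ∈ s, ‖weakDeriv U α (f i) x‖) ^ 2 := by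
        gcongr
        exact norm_sum_le _ _
    _ ≤ _ := sq_sum_le_card_mul_sum_sq

end Seminorms

/-! ### Components and L² inner products -/

section Components

variable {d : ℕ} {Ω : Set (E d)} {ν : Measure (E d)}

theorem real_inner_eq_mul (a b : ℝ) : inner ℝ a b = a * b := by
  rw [real_inner_eq_re_inner, RCLike.inner_apply, mul_comm]
  simp

theorem memLp_component {v : E d → E d} (hv : MemLp v 2 ν) (j : Fin d) :
    MemLp (fun x => v x j) 2 ν :=
  (EuclideanSpace.proj j : E d →L[ℝ] ℝ).comp_memLp' hv

theorem inner_toLp_real (q : Lp ℝ 2 ν) {b : E d → ℝ} (hb : MemLp b 2 ν) :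
    inner ℝ q (hb.toLp b) = ∫ x, q x * b x ∂ν := by
  rw [L2.inner_def]
  refine integral_congr_ae (hb.coeFn_toLp.mono fun x hx => ?_)
  simp only [hx, real_inner_eq_mul]

theorem toLp_inner_toLp_real {a b : E d → ℝ} (ha : MemLp a 2 ν) (hb : MemLp b 2 ν) :
    inner ℝ (ha.toLp a) (hb.toLp b) = ∫ x, a x * b x ∂ν := by
  rw [inner_toLp_real]
  exact integral_congr_ae (ha.coeFn_toLp.mono fun x hx => by simp only [hx])

theorem norm_toLp_sq {F : Type} [NormedAddCommGroup F] [InnerProductSpace ℝ F] {a : E d → F}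
    (ha : MemLp a 2 ν) : ‖ha.toLp a‖ ^ 2 = ∫ x, ‖a x‖ ^ 2 ∂ν := by
  rw [← real_inner_self_eq_norm_sq, L2.inner_def]
  refine integral_congr_ae (ha.coeFn_toLp.mono fun x hx => ?_)
  simp only [hx, real_inner_self_eq_norm_sq]

theorem inner_eq_sum_component (v w : E d) : inner ℝ v w = ∑ i, v i * w i := by
  rw [PiLp.inner_apply]
  exact Finset.sum_congr rfl fun i _ => by rw [real_inner_eq_mul]

end Components

/-! ### Gradients as Hilbert space elements; the forms a and b -/

section Gradient

variable {d : ℕ} {Ω : Set (E d)}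

/-- Square integrable matrix fields on `Ω`, with the Frobenius inner product. -/
abbrev MatrixField (Ω : Set (E d)) : Type := PiLp 2 fun _ : Fin d × Fin d => L2 Ω ℝ

theorem memLp_weakPartial_component (Ω : Set (E d)) (i j : Fin d) (v : E d → E d) :
    MemLp (fun x => weakPartial Ω i v x j) 2 (volume.restrict Ω) :=
  memLp_component (memLp_weakPartial Ω i v) j

/-- The gradient field with entries `∂_i v_j`. -/
def gradField (Ω : Set (E d)) (v : E d → E d) : MatrixField Ω :=
  WithLp.toLp 2 fun ij => (memLp_weakPartial_component Ω ij.1 ij.2 v).toLp _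

theorem gradField_apply (v : E d → E d) (i j : Fin d) :
    gradField Ω v (i, j) = (memLp_weakPartial_component Ω i j v).toLp _ := rfl

theorem gradField_congr {v w : E d → E d} (h : v =ᵐ[volume.restrict Ω] w) :
    gradField Ω v = gradField Ω w := by
  simp only [gradField, weakPartial, weakDeriv_congr _ h]

theorem gradField_add (hΩ : IsOpen Ω) {v w : E d → E d} (hv : MemH 1 Ω v) (hw : MemH 1 Ω w) :
    gradField Ω (fun x => v x + w x) = gradField Ω v + gradField Ω w := by
  ext1 ⟨i, j⟩
  rw [PiLp.add_apply, gradField_apply, gradField_apply, gradField_apply, ← MemLp.toLp_add]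
  refine MemLp.toLp_congr _ _ ?_
  filter_upwards [hv.weakDeriv_add hΩ hw le_rfl fun _ => i] with x hx
  simp only [weakPartial, hx, PiLp.add_apply, Pi.add_apply]

theorem gradField_smul (hΩ : IsOpen Ω) (c : ℝ) {v : E d → E d} (hv : MemH 1 Ω v) :
    gradField Ω (fun x => c • v x) = c • gradField Ω v := by
  ext1 ⟨i, j⟩
  rw [PiLp.smul_apply, gradField_apply, gradField_apply, ← MemLp.toLp_const_smul]
  refine MemLp.toLp_congr _ _ ?_
  filter_upwards [hv.weakDeriv_clm_comp hΩ (c • ContinuousLinearMap.id ℝ (E d)) le_rfl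
    fun _ => i] with x hx
  simp only [smul_apply, ContinuousLinearMap.id_apply] at hx
  simp only [weakPartial, hx, PiLp.smul_apply, Pi.smul_apply]

theorem MemH.smul {m : ℕ} (c : ℝ) {v : E d → E d} (hv : MemH m Ω v) :
    MemH m Ω fun x => c • v x :=
  hv.clm_comp (c • ContinuousLinearMap.id ℝ (E d))

theorem MemH.sub {m : ℕ} {v w : E d → E d} (hv : MemH m Ω v) (hw : MemH m Ω w) :
    MemH m Ω fun x => v x - w x := by
  simpa [sub_eq_add_neg] using hv.add (hw.smul (-1))

theorem gradField_sub (hΩ : IsOpen Ω) {v w : E d → E d} (hv : MemH 1 Ω v) (hw : MemH 1 Ω w) :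
    gradField Ω (fun x => v x - w x) = gradField Ω v - gradField Ω w := by
  have h := gradField_add hΩ hv (hw.smul (-1))
  rw [gradField_smul hΩ _ hw] at h
  simpa [sub_eq_add_neg] using h

theorem norm_gradField (v : E d → E d) : ‖gradField Ω v‖ = hSeminorm 1 Ω v := by
  rw [← sq_eq_sq₀ (norm_nonneg _) (hSeminorm_nonneg _ _ _), hSeminorm_one_sq,
    PiLp.norm_sq_eq_of_L2, Fintype.sum_prod_type]
  refine Finset.sum_congr rfl fun i _ => ?_
  simp_rw [gradField_apply, norm_toLp_sq, EuclideanSpace.norm_sq_eq]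
  rw [integral_finsetSum]
  exact fun j _ => integrable_norm_sq (memLp_weakPartial_component Ω i j v)

/-- Transposition of matrix fields. -/
def transposeField (Ω : Set (E d)) : MatrixField Ω ≃ₗᵢ[ℝ] MatrixField Ω :=
  LinearIsometryEquiv.piLpCongrLeft 2 ℝ (L2 Ω ℝ) (Equiv.prodComm (Fin d) (Fin d))

theorem transposeField_apply (g : MatrixField Ω) (i j : Fin d) :
    transposeField Ω g (i, j) = g (j, i) := by
  simp [transposeField, LinearIsometryEquiv.piLpCongrLeft_apply, Equiv.piCongrLeft',
    Equiv.prodComm]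

theorem inner_transposeField (g h : MatrixField Ω) :
    inner ℝ (transposeField Ω g) h = inner ℝ g (transposeField Ω h) := by
  rw [PiLp.inner_apply, PiLp.inner_apply, ← (Equiv.prodComm (Fin d) (Fin d)).sum_comp]
  refine Finset.sum_congr rfl fun ⟨i, j⟩ _ => ?_
  simp [transposeField_apply]

theorem transposeField_transposeField (g : MatrixField Ω) :
    transposeField Ω (transposeField Ω g) = g := by
  ext1 ⟨i, j⟩
  simp [transposeField_apply]

/-- The symmetric part of a matrix field. -/
def symField (Ω : Set (E d)) : MatrixField Ω →L[ℝ] MatrixField Ω :=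
  (1 / 2 : ℝ) • (ContinuousLinearMap.id ℝ _ +
    (transposeField Ω).toContinuousLinearEquiv.toContinuousLinearMap)

theorem symField_eq (g : MatrixField Ω) :
    symField Ω g = (1 / 2 : ℝ) • (g + transposeField Ω g) := rfl

theorem norm_symField_le (g : MatrixField Ω) : ‖symField Ω g‖ ≤ ‖g‖ := by
  have h := norm_add_le g (transposeField Ω g)
  rw [LinearIsometryEquiv.norm_map] at h
  rw [symField_eq, norm_smul]
  norm_num
  linarith

/-- Symmetrization is an orthogonal projection, since transposition is a self-adjoint involution. -/
theorem inner_symField_symField (g h : MatrixField Ω) :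
    inner ℝ (symField Ω g) (symField Ω h) = inner ℝ (symField Ω g) h := by
  simp only [symField_eq, inner_smul_left, inner_smul_right, inner_add_left, inner_add_right,
    inner_transposeField, transposeField_transposeField]
  simp
  ring

theorem two_mul_norm_symField_sq (g : MatrixField Ω) :
    2 * ‖symField Ω g‖ ^ 2 = ‖g‖ ^ 2 + inner ℝ g (transposeField Ω g) := by
  rw [← real_inner_self_eq_norm_sq, inner_symField_symField, symField_eq, inner_smul_left,
    inner_add_left, inner_transposeField, real_inner_self_eq_norm_sq]
  simp

theorem memLp_strain (Ω : Set (E d)) (v : E d → E d) (i j : Fin d) :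
    MemLp (strain Ω v i j) 2 (volume.restrict Ω) := by
  have h := ((memLp_weakPartial_component Ω i j v).add
    (memLp_weakPartial_component Ω j i v)).const_mul (1 / 2)
  refine (memLp_congr_ae (.of_forall fun x => ?_)).1 h
  simp only [strain, Pi.add_apply]
  ring

theorem symField_gradField_apply (v : E d → E d) (i j : Fin d) :
    symField Ω (gradField Ω v) (i, j) = (memLp_strain Ω v i j).toLp _ := by
  rw [symField_eq, PiLp.smul_apply, PiLp.add_apply, transposeField_apply, gradField_apply,
    gradField_apply, ← MemLp.toLp_add, ← MemLp.toLp_const_smul]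
  refine MemLp.toLp_congr _ _ (.of_forall fun x => ?_)
  simp only [strain, Pi.add_apply, Pi.smul_apply, smul_eq_mul]
  ring

theorem aForm_eq_inner (μ : ℝ) (u v : E d → E d) : aForm Ω μ u v =
    2 * μ * inner ℝ (symField Ω (gradField Ω u)) (symField Ω (gradField Ω v)) := by
  have hint : ∀ i j, Integrable (fun x => strain Ω u i j x * strain Ω v i j x)
      (volume.restrict Ω) := fun i j => (memLp_strain Ω u i j).integrable_mul (memLp_strain Ω v i j)
  rw [aForm, PiLp.inner_apply, Fintype.sum_prod_type,
    integral_finsetSum _ fun i _ => integrable_finsetSum _ fun j _ => hint i j]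
  congr 1
  refine Finset.sum_congr rfl fun i _ => ?_
  rw [integral_finsetSum _ fun j _ => hint i j]
  refine Finset.sum_congr rfl fun j _ => ?_
  rw [symField_gradField_apply, symField_gradField_apply, toLp_inner_toLp_real]

/-- The trace of a matrix field. -/
def traceField (Ω : Set (E d)) : MatrixField Ω →L[ℝ] L2 Ω ℝ :=
  ∑ i : Fin d, PiLp.proj 2 (fun _ : Fin d × Fin d => L2 Ω ℝ) (i, i)

theorem traceField_apply (g : MatrixField Ω) : traceField Ω g = ∑ i, g (i, i) := by
  simp [traceField]

theorem apply_eq_sum_single {F : Type} [AddCommGroup F] [Module ℝ F] [TopologicalSpace F]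
    (A : E d →L[ℝ] F) (v : E d) : A v = ∑ i, v i • A (EuclideanSpace.single i 1) := by
  conv_lhs => rw [← (EuclideanSpace.basisFun (Fin d) ℝ).sum_repr v]
  simp [map_sum]

/-- `divergence` is chosen independently of the weak partials; the trace of the gradient is also a
weak divergence, and uniqueness identifies the two. -/
theorem divergence_ae_eq (hΩ : IsOpen Ω) {v : E d → E d} (hv : MemH 1 Ω v) :
    divergence Ω v =ᵐ[volume.restrict Ω] fun x => ∑ i, weakPartial Ω i v x i := by
  have hmem : MemLp (fun x => ∑ i, weakPartial Ω i v x i) 2 (volume.restrict Ω) :=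
    memLp_finsetSum _ fun i _ => memLp_weakPartial_component Ω i i v
  have hdiv : IsWeakDiv Ω v fun x => ∑ i, weakPartial Ω i v x i := by
    intro φ hφ
    simp_rw [apply_eq_sum_single (fderiv ℝ φ _) (v _), Finset.mul_sum]
    rw [integral_finsetSum, integral_finsetSum, ← Finset.sum_neg_distrib]
    · refine Finset.sum_congr rfl fun i _ => ?_
      have h := ((isWeakDeriv_weakDeriv (hv.2 1 le_rfl fun _ => i)).clm_comp
        (EuclideanSpace.proj i : E d →L[ℝ] ℝ) hv.1 (memLp_weakDeriv _ _ _)) φ hφ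
      simpa [partialDeriv_one, mul_comm, weakPartial] using h
    · exact fun i _ => hφ.integrable_smul (memLp_weakPartial_component Ω i i v)
    · intro i _
      simpa [mul_comm] using
        (hφ.fderiv_apply (EuclideanSpace.single i 1)).integrable_smul (memLp_component hv.1 i)
  have hex : ∃ g : E d → ℝ, MemLp g 2 (volume.restrict Ω) ∧ IsWeakDiv Ω v g := ⟨_, hmem, hdiv⟩
  have hdef : divergence Ω v = hex.choose := dif_pos hex
  rw [hdef]
  refine ae_eq_of_forall_isTestFun hΩ hex.choose_spec.1 hmem fun φ hφ => ?_
  simpa using (hex.choose_spec.2 φ hφ).symm.trans (hdiv φ hφ)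

theorem traceField_gradField_ae_eq (hΩ : IsOpen Ω) {v : E d → E d} (hv : MemH 1 Ω v) :
    traceField Ω (gradField Ω v) =ᵐ[volume.restrict Ω] divergence Ω v := by
  rw [traceField_apply]
  refine (Lp.coeFn_fun_finsetSum _ _).trans ?_
  have h : ∀ᵐ x ∂volume.restrict Ω, ∀ i, gradField Ω v (i, i) x = weakPartial Ω i v x i :=
    ae_all_iff.2 fun i => (memLp_weakPartial_component Ω i i v).coeFn_toLp
  filter_upwards [h, divergence_ae_eq hΩ hv] with x h1 h2
  rw [h2]
  exact Finset.sum_congr rfl fun i _ => h1 i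

theorem bForm_eq_inner (hΩ : IsOpen Ω) (q : L2 Ω ℝ) {v : E d → E d} (hv : MemH 1 Ω v) :
    bForm Ω q v = inner ℝ q (traceField Ω (gradField Ω v)) := by
  rw [L2.inner_def, bForm]
  refine integral_congr_ae ((traceField_gradField_ae_eq hΩ hv).mono fun x hx => ?_)
  simp only [hx, real_inner_eq_mul]

end Gradient

/-! ### Density of test fields, Korn's inequality, integration by parts -/

section ZeroBoundaryValues

variable {d : ℕ} {Ω : Set (E d)}

theorem norm_eq_hSeminorm_zero (hΩ : IsOpen Ω) (v : L2 Ω (E d)) : ‖v‖ = hSeminorm 0 Ω v := by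
  rw [← sq_eq_sq₀ (norm_nonneg _) (hSeminorm_nonneg _ _ _), hSeminorm_zero_sq hΩ (Lp.memLp v),
    ← norm_toLp_sq (Lp.memLp v), Lp.toLp_coeFn]

/-- A closed relation between a field and its gradient that holds for all test fields holds on
`H^1_0`. -/
theorem MemH10.mem_of_isClosed (hΩ : IsOpen Ω) {v : L2 Ω (E d)} (hv : MemH10 Ω v)
    {S : Set (L2 Ω (E d) × MatrixField Ω)} (hS : IsClosed S)
    (h : ∀ (φ : E d → E d) (hφ : IsTestFun Ω φ), ((hφ.memLp 2 _).toLp φ, gradField Ω φ) ∈ S) :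
    (v, gradField Ω v) ∈ S := by
  rw [← hS.closure_eq, Metric.mem_closure_iff]
  intro ε hε
  obtain ⟨φ, hφ, hlt⟩ := hv.2 ε hε
  refine ⟨_, h φ hφ, ?_⟩
  rw [Prod.dist_eq, max_lt_iff]
  constructor
  · refine lt_of_le_of_lt ?_ hlt
    rw [dist_eq_norm, norm_eq_hSeminorm_zero hΩ]
    refine le_of_eq_of_le (hSeminorm_congr 0 ?_) (hSeminorm_le_hNorm zero_le_one _ _)
    filter_upwards [Lp.coeFn_sub v ((hφ.memLp 2 _).toLp φ),
      (hφ.memLp 2 (volume.restrict Ω)).coeFn_toLp] with x h1 h2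
    rw [h1, Pi.sub_apply, h2]
  · refine lt_of_le_of_lt ?_ hlt
    rw [dist_eq_norm, ← gradField_sub hΩ hv.1 hφ.memH, norm_gradField]
    exact hSeminorm_le_hNorm le_rfl _ _

/-- Moving the derivative from a to b turns both sides into minus the integral of a times a mixed
second derivative of b, and these are symmetric. -/
theorem IsTestFun.setIntegral_fderiv_mul_comm {a b : E d → ℝ} (ha : IsTestFun Ω a)
    (hb : IsTestFun Ω b) (i j : Fin d) :
    ∫ x in Ω, fderiv ℝ a x (EuclideanSpace.single i 1) * fderiv ℝ b x (EuclideanSpace.single j 1) =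
    ∫ x in Ω, fderiv ℝ a x (EuclideanSpace.single j 1) *
      fderiv ℝ b x (EuclideanSpace.single i 1) := by
  have h1 := (hb.fderiv_apply (EuclideanSpace.single j 1)).isWeakDeriv i a ha
  have h2 := (hb.fderiv_apply (EuclideanSpace.single i 1)).isWeakDeriv j a ha
  simp only [partialDeriv_one, smul_eq_mul] at h1 h2
  rw [h1, h2]
  congr 2
  funext x
  have hs : IsSymmSndFDerivAt ℝ b x := hb.1.contDiffAt.isSymmSndFDerivAt (by
    rw [minSmoothness_of_isRCLikeNormedField]
    exact WithTop.coe_le_coe.2 (le_top : (2 : ℕ∞) ≤ ⊤))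
  have hd : DifferentiableAt ℝ (fderiv ℝ b) x :=
    ((hb.1.fderiv_right (m := ∞) (by exact_mod_cast le_top)).differentiable (by simp)) x
  rw [fderiv_clm_apply hd (differentiableAt_const _), fderiv_clm_apply hd (differentiableAt_const _)]
  simp [hs.eq]

theorem IsTestFun.fderiv_component {φ : E d → E d} (hφ : IsTestFun Ω φ) (x v : E d) (j : Fin d) :
    fderiv ℝ φ x v j = fderiv ℝ (fun y => φ y j) x v := by
  have h := (((EuclideanSpace.proj j : E d →L[ℝ] ℝ).hasFDerivAt).comp x
    ((hφ.1.differentiable (by simp)) x).hasFDerivAt).fderiv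
  exact (congrArg (fun A => A v) h).symm

theorem IsTestFun.component {φ : E d → E d} (hφ : IsTestFun Ω φ) (j : Fin d) :
    IsTestFun Ω fun x => φ x j :=
  hφ.clm_comp (EuclideanSpace.proj j : E d →L[ℝ] ℝ)

theorem IsTestFun.gradField_apply (hΩ : IsOpen Ω) {φ : E d → E d} (hφ : IsTestFun Ω φ)
    (i j : Fin d) : gradField Ω φ (i, j) =
      (((hφ.component j).fderiv_apply (EuclideanSpace.single i 1)).memLp 2 _).toLp _ := by
  rw [MixedElasticity.gradField_apply]
  refine MemLp.toLp_congr _ _ ?_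
  filter_upwards [hφ.weakPartial_ae_eq hΩ i] with x hx
  rw [hx, hφ.fderiv_component]

/-- Exchanging the two derivatives turns ∂_i φ_j ∂_j φ_i into ∂_j φ_j ∂_i φ_i under the integral,
whose sum is the squared divergence. -/
theorem IsTestFun.inner_transposeField (hΩ : IsOpen Ω) {φ : E d → E d} (hφ : IsTestFun Ω φ) :
    inner ℝ (gradField Ω φ) (transposeField Ω (gradField Ω φ)) =
      ‖traceField Ω (gradField Ω φ)‖ ^ 2 := by
  rw [← real_inner_self_eq_norm_sq, traceField_apply, sum_inner, PiLp.inner_apply,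
    Fintype.sum_prod_type]
  refine Finset.sum_congr rfl fun i _ => ?_
  rw [inner_sum]
  refine Finset.sum_congr rfl fun j _ => ?_
  rw [transposeField_apply, hφ.gradField_apply hΩ, hφ.gradField_apply hΩ, hφ.gradField_apply hΩ,
    hφ.gradField_apply hΩ, toLp_inner_toLp_real, toLp_inner_toLp_real,
    (hφ.component j).setIntegral_fderiv_mul_comm (hφ.component i)]
  simp_rw [mul_comm]

/-- Korn's first inequality. -/
theorem MemH10.norm_gradField_sq_le (hΩ : IsOpen Ω) {v : L2 Ω (E d)} (hv : MemH10 Ω v) :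
    ‖gradField Ω v‖ ^ 2 ≤ 2 * ‖symField Ω (gradField Ω v)‖ ^ 2 := by
  rw [two_mul_norm_symField_sq]
  -- The defect in Korn's inequality is the inner product of the gradient with its transpose. On
  -- test fields it is a square, and nonnegativity survives limits in H^1.
  have hS : IsClosed {w : L2 Ω (E d) × MatrixField Ω | 0 ≤ inner ℝ w.2 (transposeField Ω w.2)} :=
    isClosed_le continuous_const
      (continuous_snd.inner ((transposeField Ω).continuous.comp continuous_snd))
  have h : 0 ≤ inner ℝ (gradField Ω v) (transposeField Ω (gradField Ω v)) :=
    hv.mem_of_isClosed hΩ hS fun φ hφ => by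
      rw [mem_ofPred_eq, hφ.inner_transposeField hΩ]
      positivity
  linarith

/-- The row-wise divergence of the strain of `u`. -/
def divStrain (Ω : Set (E d)) (u : E d → E d) (x : E d) : E d :=
  WithLp.toLp 2 fun i => ∑ j, weakPartial Ω j (strain Ω u i j) x

theorem memLp_divStrain_component (Ω : Set (E d)) (u : E d → E d) (i : Fin d) :
    MemLp (fun x => divStrain Ω u x i) 2 (volume.restrict Ω) := by
  change MemLp (fun x => ∑ j, weakPartial Ω j (strain Ω u i j) x) 2 _
  exact memLp_finsetSum _ fun j _ => memLp_weakPartial Ω j (strain Ω u i j)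

theorem memLp_divStrain (Ω : Set (E d)) (u : E d → E d) :
    MemLp (divStrain Ω u) 2 (volume.restrict Ω) := by
  have h : divStrain Ω u = fun x => ∑ i, (ContinuousLinearMap.toSpanSingleton ℝ
      (EuclideanSpace.single i (1 : ℝ))) (divStrain Ω u x i) := by
    funext x
    ext j
    simp [Pi.single_apply]
  rw [h]
  exact memLp_finsetSum _ fun i _ =>
    ContinuousLinearMap.comp_memLp' _ (memLp_divStrain_component Ω u i)

theorem strain_comm (Ω : Set (E d)) (u : E d → E d) (i j : Fin d) :
    strain Ω u i j = strain Ω u j i := by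
  funext x
  simp only [strain, add_comm]

/-- The linear map `w ↦ w_j / 2`. -/
def halfComponent (j : Fin d) : E d →L[ℝ] ℝ := (1 / 2 : ℝ) • EuclideanSpace.proj j

theorem strain_eq (Ω : Set (E d)) (u : E d → E d) (i j : Fin d) : strain Ω u i j =
    fun x => halfComponent j (weakPartial Ω i u x) + halfComponent i (weakPartial Ω j u x) := by
  funext x
  simp [strain, halfComponent]
  ring

theorem MemH.strain {m : ℕ} {u : E d → E d} (hu : MemH (m + 1) Ω u) (i j : Fin d) :
    MemH m Ω (strain Ω u i j) := by
  rw [strain_eq]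
  exact ((hu.weakPartial i).clm_comp _).add ((hu.weakPartial j).clm_comp _)

/-- Integration by parts: `(ε(u), ε(v)) = -(∇ · ε(u), v)` for `v ∈ H^1_0`. -/
theorem MemH10.inner_symField_gradField (hΩ : IsOpen Ω) {u : E d → E d} (hu : MemH 2 Ω u)
    {v : L2 Ω (E d)} (hv : MemH10 Ω v) :
    inner ℝ (symField Ω (gradField Ω u)) (symField Ω (gradField Ω v)) =
      -inner ℝ ((memLp_divStrain Ω u).toLp _) v := by
  -- As ε(u) is symmetric, ε(v) may be replaced by ∇v, which makes the relation linear in v and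
  -- checkable entry by entry on test fields.
  rw [inner_symField_symField]
  have hS : IsClosed {w : L2 Ω (E d) × MatrixField Ω |
      inner ℝ (symField Ω (gradField Ω u)) w.2 = -inner ℝ ((memLp_divStrain Ω u).toLp _) w.1} :=
    isClosed_eq (continuous_const.inner continuous_snd) (continuous_const.inner continuous_fst).neg
  refine hv.mem_of_isClosed hΩ hS fun φ hφ => ?_
  rw [mem_ofPred_eq, PiLp.inner_apply, Fintype.sum_prod_type_right, L2.inner_def]
  have h1 : ∫ x in Ω, inner ℝ ((memLp_divStrain Ω u).toLp _ x)
      ((hφ.memLp 2 (volume.restrict Ω)).toLp φ x) =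
      ∫ x in Ω, ∑ j, ∑ i, φ x j * weakPartial Ω i (MixedElasticity.strain Ω u j i) x := by
    refine integral_congr_ae ?_
    filter_upwards [(memLp_divStrain Ω u).coeFn_toLp,
      (hφ.memLp 2 (volume.restrict Ω)).coeFn_toLp] with x h1 h2
    rw [h1, h2, inner_eq_sum_component]
    refine Finset.sum_congr rfl fun j _ => ?_
    rw [mul_comm, ← Finset.mul_sum]
    rfl
  have hint : ∀ i j, Integrable
      (fun x => φ x j * weakPartial Ω i (MixedElasticity.strain Ω u j i) x) (volume.restrict Ω) :=
    fun i j => (hφ.component j).integrable_smul (memLp_weakPartial _ _ _)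
  rw [h1, integral_finsetSum _ fun j _ => integrable_finsetSum _ fun i _ => hint i j,
    ← Finset.sum_neg_distrib]
  refine Finset.sum_congr rfl fun j _ => ?_
  rw [integral_finsetSum _ fun i _ => hint i j, ← Finset.sum_neg_distrib]
  refine Finset.sum_congr rfl fun i _ => ?_
  have h2 := isWeakDeriv_weakDeriv ((hu.strain j i).2 1 le_rfl fun _ => i) _ (hφ.component j)
  rw [symField_gradField_apply, hφ.gradField_apply hΩ, toLp_inner_toLp_real, strain_comm]
  simpa [partialDeriv_one, mul_comm, weakPartial] using h2

end ZeroBoundaryValues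

/-! ### Abstract approximation in the discrete kernel -/

section InfSup

variable {H L : Type*} [NormedAddCommGroup H] [InnerProductSpace ℝ H]
  [NormedAddCommGroup L] [InnerProductSpace ℝ L]

/-- Under the inf-sup condition, an element of the kernel of `q ↦ ⟪q, D ·⟫` is approximated by the
discrete kernel as well as by the full discrete space. -/
theorem exists_discrete_kernel_approx [CompleteSpace H] [CompleteSpace L] (D : H →L[ℝ] L)
    (W : Submodule ℝ H) (Q : Submodule ℝ L) [FiniteDimensional ℝ W] [FiniteDimensional ℝ Q]
    {γ : ℝ} (hγ : 0 < γ)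
    (hWQ : ∀ q ∈ Q, q ≠ 0 → ∃ w ∈ W, w ≠ 0 ∧ γ * ‖q‖ * ‖w‖ ≤ inner ℝ q (D w))
    {y : H} (hy : ∀ q ∈ Q, inner ℝ q (D y) = 0) {g : H} (hg : g ∈ W) :
    ∃ z ∈ W, (∀ q ∈ Q, inner ℝ q (D z) = 0) ∧ ‖y - z‖ ≤ (1 + ‖D‖ / γ) * ‖y - g‖ := by
  -- B q is the Riesz representative in W of w ↦ ⟪q, D w⟫, so inf-sup stability says that B is
  -- bounded below on Q.
  let B : L →L[ℝ] H := W.starProjection ∘L ContinuousLinearMap.adjoint D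
  have hBW : ∀ q, B q ∈ W := fun q => W.starProjection_apply_mem _
  have hB : ∀ q, ∀ w ∈ W, inner ℝ (B q) w = inner ℝ q (D w) := by
    intro q w hw
    rw [← ContinuousLinearMap.adjoint_inner_left]
    change inner ℝ (W.starProjection _) w = _
    rw [Submodule.inner_starProjection_left_eq_right, Submodule.starProjection_eq_self_iff.2 hw]
    rfl
  have hBq : ∀ q ∈ Q, γ * ‖q‖ ≤ ‖B q‖ := by
    intro q hq
    rcases eq_or_ne q 0 with rfl | hq0
    · simp
    obtain ⟨w, hw, hw0, hle⟩ := hWQ q hq hq0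
    rw [← hB q w hw] at hle
    exact le_of_mul_le_mul_right (hle.trans (real_inner_le_norm _ _)) (norm_pos_iff.2 hw0)
  -- The discrete kernel is the orthogonal complement of R = B(Q) within W, so the witness is g
  -- minus its projection onto R.
  let R : Submodule ℝ H := Q.map (B : L →ₗ[ℝ] H)
  have hRW : R ≤ W := by
    rintro _ ⟨q, _, rfl⟩
    exact hBW q
  have hwR : R.starProjection g ∈ R := R.starProjection_apply_mem g
  set w := R.starProjection g with hw
  refine ⟨g - w, W.sub_mem hg (hRW hwR), fun q hq => ?_, ?_⟩
  · rw [← hB q _ (W.sub_mem hg (hRW hwR))]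
    exact R.sub_starProjection_mem_orthogonal g _ (Submodule.mem_map_of_mem hq)
  · obtain ⟨q, hq, hqw⟩ := hwR
    have hqw : B q = w := hqw
    have h1 : ‖w‖ ^ 2 = inner ℝ w g := by
      rw [← real_inner_self_eq_norm_sq, hw, Submodule.inner_starProjection_left_eq_right,
        Submodule.starProjection_eq_self_iff.2 (R.starProjection_apply_mem g), real_inner_comm]
    -- Since y is in the kernel, g may be replaced by g - y: the correction is controlled by the
    -- approximation error alone.
    have h2 : inner ℝ w g = inner ℝ q (D (g - y)) := by
      rw [← hqw, hB q g hg, map_sub, inner_sub_right, hy q hq, sub_zero]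
    have h3 : ‖w‖ * (γ * ‖w‖) ≤ ‖w‖ * (‖D‖ * ‖y - g‖) := by
      calc ‖w‖ * (γ * ‖w‖) = γ * inner ℝ q (D (g - y)) := by rw [← h2, ← h1]; ring
        _ ≤ γ * (‖q‖ * ‖D (g - y)‖) := by gcongr; exact real_inner_le_norm _ _
        _ ≤ γ * (‖q‖ * (‖D‖ * ‖g - y‖)) := by gcongr; exact D.le_opNorm _
        _ = γ * ‖q‖ * (‖D‖ * ‖y - g‖) := by rw [norm_sub_rev]; ring
        _ ≤ ‖w‖ * (‖D‖ * ‖y - g‖) := by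
          gcongr
          rw [← hqw]
          exact hBq q hq
    have h4 : ‖w‖ ≤ ‖D‖ / γ * ‖y - g‖ := by
      rw [div_mul_eq_mul_div, le_div_iff₀ hγ, mul_comm]
      rcases (norm_nonneg w).eq_or_lt with h0 | h0
      · rw [← h0, mul_zero]
        positivity
      · exact le_of_mul_le_mul_left h3 h0
    calc ‖y - (g - w)‖ = ‖(y - g) + w‖ := by congr 1; abel
      _ ≤ ‖y - g‖ + ‖w‖ := norm_add_le _ _
      _ ≤ _ := by rw [add_mul, one_mul]; gcongr

end InfSup

/-! ### Elementwise bounds for the strain and its divergence -/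

section LocalBounds

variable {d : ℕ} {F : Type} [NormedAddCommGroup F] [NormedSpace ℝ F] [CompleteSpace F]
  {Ω U T : Set (E d)} {m n : ℕ}

theorem MemH.hSeminorm_add_sq_le (hU : IsOpen U) {f g : E d → F} (hf : MemH m U f)
    (hg : MemH m U g) (hn : n ≤ m) : hSeminorm n U (fun x => f x + g x) ^ 2 ≤
      2 * (hSeminorm n U f ^ 2 + hSeminorm n U g ^ 2) := by
  have h := MemH.hSeminorm_sum_sq_le (n := n) (f := fun b : Bool => cond b f g) hU Finset.univ
    (by rintro (_ | _) _ <;> assumption) hn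
  simpa using h

theorem ae_restrict_of_subset {p : E d → Prop} (hTU : T ⊆ U)
    (h : ∀ᵐ x ∂volume.restrict U, p x) : ∀ᵐ x ∂volume.restrict T, p x :=
  ae_mono (Measure.restrict_mono hTU le_rfl) h

theorem MemH.weakPartial_restrict (hU : IsOpen U) (hT : IsOpen T) (hTU : T ⊆ U) {f : E d → F}
    (hf : MemH m U f) (hm : 1 ≤ m) (i : Fin d) :
    MixedElasticity.weakPartial U i f =ᵐ[volume.restrict T] MixedElasticity.weakPartial T i f :=
  (weakDeriv_restrict hU hT hTU (hf.2 1 hm _)).symm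

theorem MemH.hSeminorm_weakPartial_restrict_le (hU : IsOpen U) (hT : IsOpen T) (hTU : T ⊆ U)
    {f : E d → F} (hf : MemH m U f) (hn : n + 1 ≤ m) (i : Fin d) :
    hSeminorm n T (MixedElasticity.weakPartial U i f) ≤ hSeminorm (n + 1) T f := by
  rw [hSeminorm_congr n (hf.weakPartial_restrict hU hT hTU (by omega) i)]
  exact (hf.restrict hU hTU).hSeminorm_weakPartial_le hT hn i

theorem norm_halfComponent_le (j : Fin d) : ‖halfComponent j‖ ≤ 1 := by
  refine ContinuousLinearMap.opNorm_le_bound _ zero_le_one fun w => ?_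
  have h := PiLp.norm_apply_le w j
  have h0 := norm_nonneg (w j)
  have h1 : halfComponent j w = (1 / 2 : ℝ) * w j := rfl
  rw [h1, norm_mul]
  norm_num at h h0 ⊢
  linarith [abs_nonneg (w j)]

theorem MemH.hSeminorm_clm_comp_le_of_norm_le_one {G : Type} [NormedAddCommGroup G]
    [NormedSpace ℝ G] [CompleteSpace G] (hU : IsOpen U) {A : F →L[ℝ] G} (hA : ‖A‖ ≤ 1)
    {f : E d → F} (hf : MemH m U f) (hn : n ≤ m) :
    hSeminorm n U (fun x => A (f x)) ^ 2 ≤ hSeminorm n U f ^ 2 := by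
  refine (hf.hSeminorm_clm_comp_le hU A hn).trans ?_
  exact mul_le_of_le_one_left (by positivity) (pow_le_one₀ (norm_nonneg A) hA)

/-- The 4 comes from bounding the square of a two-term sum by twice the sum of squares, each at most
|u|²; the factor 1/2 in the strain is simply given away. -/
theorem MemH.hSeminorm_strain_sq_le (hΩ : IsOpen Ω) (hT : IsOpen T) (hTΩ : T ⊆ Ω)
    {u : E d → E d} (hu : MemH m Ω u) (hn : n + 1 ≤ m) (i j : Fin d) :
    hSeminorm n T (MixedElasticity.strain Ω u i j) ^ 2 ≤ 4 * hSeminorm (n + 1) T u ^ 2 := by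
  obtain ⟨m, rfl⟩ : ∃ l, m = l + 1 := ⟨m - 1, by omega⟩
  have hp : ∀ i, MemH m T (MixedElasticity.weakPartial Ω i u) := fun i =>
    (hu.weakPartial i).restrict hΩ hTΩ
  have hle : ∀ i j, hSeminorm n T
      (fun x => halfComponent j (MixedElasticity.weakPartial Ω i u x)) ^ 2 ≤
        hSeminorm (n + 1) T u ^ 2 := fun i j =>
    ((hp i).hSeminorm_clm_comp_le_of_norm_le_one hT (norm_halfComponent_le j) (by omega)).trans
      (pow_le_pow_left₀ (hSeminorm_nonneg _ _ _)
        (hu.hSeminorm_weakPartial_restrict_le hΩ hT hTΩ hn i) 2)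
  rw [strain_eq]
  have h := ((hp i).clm_comp (halfComponent j)).hSeminorm_add_sq_le hT
    ((hp j).clm_comp (halfComponent i)) (n := n) (by omega)
  linarith [hle i j, hle j i]

theorem divStrain_eq_sum (Ω : Set (E d)) (u : E d → E d) :
    divStrain Ω u = fun x => ∑ ij : Fin d × Fin d, ContinuousLinearMap.toSpanSingleton ℝ
      (EuclideanSpace.single ij.1 (1 : ℝ)) (weakPartial Ω ij.2 (strain Ω u ij.1 ij.2) x) := by
  funext x
  ext l
  simp [Fintype.sum_prod_type, Pi.single_apply, divStrain]

theorem MemH.divStrain {u : E d → E d} (hu : MemH (m + 2) Ω u) : MemH m Ω (divStrain Ω u) := by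
  rw [divStrain_eq_sum]
  exact MemH.sum _ fun ij _ => ((hu.strain ij.1 ij.2).weakPartial ij.2).clm_comp _

theorem MemH.hSeminorm_divStrain_le (hΩ : IsOpen Ω) (hT : IsOpen T) (hTΩ : T ⊆ Ω)
    {u : E d → E d} (hu : MemH (m + 2) Ω u) (hn : n ≤ m) :
    hSeminorm n T (MixedElasticity.divStrain Ω u) ≤ 2 * d ^ 2 * hSeminorm (n + 2) T u := by
  rw [← sq_le_sq₀ (hSeminorm_nonneg _ _ _) (mul_nonneg (by positivity) (hSeminorm_nonneg _ _ _)),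
    divStrain_eq_sum]
  have hp : ∀ i j, MemH m T (MixedElasticity.weakPartial Ω j (MixedElasticity.strain Ω u i j)) :=
    fun i j => ((hu.strain i j).weakPartial j).restrict hΩ hTΩ
  refine (MemH.hSeminorm_sum_sq_le hT _ (fun ij _ => (hp ij.1 ij.2).clm_comp _) hn).trans ?_
  have hle : ∀ ij : Fin d × Fin d, hSeminorm n T (fun x => ContinuousLinearMap.toSpanSingleton ℝ
      (EuclideanSpace.single ij.1 (1 : ℝ))
      (MixedElasticity.weakPartial Ω ij.2 (MixedElasticity.strain Ω u ij.1 ij.2) x)) ^ 2 ≤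
        4 * hSeminorm (n + 2) T u ^ 2 := fun ij =>
    ((hp ij.1 ij.2).hSeminorm_clm_comp_le_of_norm_le_one hT (by simp) hn).trans <|
      (pow_le_pow_left₀ (hSeminorm_nonneg _ _ _) ((hu.strain ij.1 ij.2
        ).hSeminorm_weakPartial_restrict_le hΩ hT hTΩ (by omega) ij.2) 2).trans
      (hu.hSeminorm_strain_sq_le hΩ hT hTΩ (by omega) ij.1 ij.2)
  -- Cauchy–Schwarz over d² terms, each at most 4|u|², gives 4d⁴ = (2d²)².
  calc _ ≤ ((Finset.univ : Finset (Fin d × Fin d)).card : ℝ) *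
        ∑ _ij : Fin d × Fin d, 4 * hSeminorm (n + 2) T u ^ 2 := by
        gcongr with ij
        exact hle ij
    _ = _ := by
        simp
        ring

theorem MemH.hNorm_divStrain_le (hΩ : IsOpen Ω) (hT : IsOpen T) (hTΩ : T ⊆ Ω)
    {u : E d → E d} (hu : MemH (m + 2) Ω u) :
    hNorm m T (MixedElasticity.divStrain Ω u) ≤ 2 * d ^ 2 * hNorm (m + 2) T u := by
  rw [← sq_le_sq₀ (hNorm_nonneg _ _ _) (mul_nonneg (by positivity) (hNorm_nonneg _ _ _)),
    mul_pow, hNorm_sq, hNorm_sq, Finset.sum_range_succ' _ (m + 2), Finset.sum_range_succ' _ (m + 1)]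
  calc _ ≤ ∑ n ∈ Finset.range (m + 1), (2 * d ^ 2 * hSeminorm (n + 2) T u) ^ 2 := by
        refine Finset.sum_le_sum fun n hn => pow_le_pow_left₀ (hSeminorm_nonneg _ _ _)
          (hu.hSeminorm_divStrain_le hΩ hT hTΩ ?_) 2
        have := Finset.mem_range.1 hn
        omega
    _ = (2 * d ^ 2) ^ 2 * ∑ n ∈ Finset.range (m + 1), hSeminorm (n + 2) T u ^ 2 := by
        simp_rw [mul_pow, Finset.mul_sum]
    -- Orders 0 and 1 of u have no counterpart on the left and are dropped.
    _ ≤ _ := by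
        gcongr
        rw [add_assoc]
        exact le_add_of_nonneg_right (by positivity)

theorem abs_setIntegral_inner_le (hT : IsOpen T) {a b : E d → E d}
    (ha : MemLp a 2 (volume.restrict T)) (hb : MemLp b 2 (volume.restrict T)) :
    |∫ x in T, inner ℝ (a x) (b x)| ≤ hNorm 0 T a * hNorm 0 T b := by
  have hnorm : ∀ {c : E d → E d} (hc : MemLp c 2 (volume.restrict T)),
      ‖hc.toLp c‖ = hNorm 0 T c := fun {c} hc => by
    rw [norm_eq_hSeminorm_zero hT, hNorm_zero, hSeminorm_congr 0 hc.coeFn_toLp]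
  have h := abs_real_inner_le_norm (ha.toLp a) (hb.toLp b)
  rw [hnorm, hnorm, L2.inner_def] at h
  refine le_of_eq_of_le (congrArg abs (integral_congr_ae ?_)) h
  filter_upwards [ha.coeFn_toLp, hb.coeFn_toLp] with x h1 h2
  rw [h1, h2]

end LocalBounds

/-! ### Summation over mesh elements -/

section Meshes

variable {d : ℕ} {F : Type} [NormedAddCommGroup F] [NormedSpace ℝ F] [CompleteSpace F]
  {Ω : Set (E d)} (M : Mesh Ω)

theorem Mesh.setIntegral_eq_sum {f : E d → ℝ} (hf : IntegrableOn f Ω) :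
    ∫ x in Ω, f x = ∑ T ∈ M.elems, ∫ x in T, f x := by
  have hsub : (⋃ T ∈ M.elems, T) ⊆ Ω := iUnion₂_subset M.subset
  have hae : (⋃ T ∈ M.elems, T) =ᵐ[volume] Ω :=
    hsub.eventuallyLE.antisymm (ae_le_set.2 M.covers)
  rw [← setIntegral_congr_set hae]
  exact integral_biUnion_finset M.elems (s := id) (fun T hT => (M.isOpen T hT).measurableSet)
    M.disjoint fun T hT => hf.mono_set (M.subset T hT)

theorem Mesh.hSeminorm_sq_eq_sum (hΩ : IsOpen Ω) {m n : ℕ} {f : E d → F} (hf : MemH m Ω f)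
    (hn : n ≤ m) : hSeminorm n Ω f ^ 2 = ∑ T ∈ M.elems, hSeminorm n T f ^ 2 := by
  rw [Finset.sum_congr rfl fun T hT =>
    hf.hSeminorm_sq_restrict hΩ (M.isOpen T hT) (M.subset T hT) hn, Finset.sum_comm, hSeminorm_sq]
  exact Finset.sum_congr rfl fun α _ =>
    M.setIntegral_eq_sum (integrable_norm_sq (memLp_weakDeriv Ω α f))

theorem Mesh.hNorm_sq_eq_sum (hΩ : IsOpen Ω) {m : ℕ} {f : E d → F} (hf : MemH m Ω f) :
    hNorm m Ω f ^ 2 = ∑ T ∈ M.elems, hNorm m T f ^ 2 := by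
  simp_rw [hNorm_sq]
  rw [Finset.sum_comm]
  refine Finset.sum_congr rfl fun n hn => M.hSeminorm_sq_eq_sum hΩ hf ?_
  have := Finset.mem_range.1 hn
  omega

/-- A nonempty open set in positive dimension has two points; boundedness matters because
`Metric.diam` is 0 on unbounded sets. Positivity permits division by h_T in the interpolation
estimate. -/
theorem Mesh.diam_pos (hd : 0 < d) (hΩb : Bornology.IsBounded Ω) {T : Set (E d)}
    (hT : T ∈ M.elems) : 0 < Metric.diam T := by
  have : Nonempty (Fin d) := ⟨⟨0, hd⟩⟩
  obtain ⟨x, hx⟩ := M.nonempty T hT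
  have : (nhdsWithin x {x}ᶜ).NeBot := Module.punctured_nhds_neBot ℝ (E d) x
  exact Metric.diam_pos (infinite_of_mem_nhds x ((M.isOpen T hT).mem_nhds hx)).nontrivial
    (hΩb.subset (M.subset T hT))

theorem Mesh.diam_le_size {T : Set (E d)} (hT : T ∈ M.elems) : Metric.diam T ≤ M.size :=
  le_ciSup (f := fun T : M.elems => Metric.diam (T : Set (E d))) (finite_range _).bddAbove ⟨T, hT⟩

theorem Mesh.sum_diam_pow_mul_sq_le (hΩ : IsOpen Ω) {m : ℕ} {f : E d → F} (hf : MemH m Ω f)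
    (r : ℕ) {N : Set (E d) → ℝ} (hN0 : ∀ T ∈ M.elems, 0 ≤ N T)
    (hN : ∀ T ∈ M.elems, N T ≤ hNorm m T f) :
    ∑ T ∈ M.elems, Metric.diam T ^ r * N T ^ 2 ≤ M.size ^ r * hNorm m Ω f ^ 2 := by
  rw [M.hNorm_sq_eq_sum hΩ hf, Finset.mul_sum]
  refine Finset.sum_le_sum fun T hT => ?_
  have h1 := M.diam_le_size hT
  have h2 := hN T hT
  have h3 := hN0 T hT
  have h4 : 0 ≤ Metric.diam T := Metric.diam_nonneg
  gcongr
  exact pow_nonneg (h4.trans h1) r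

end Meshes

/-! ### Consistency, stability and the error bound -/

section ErrorEstimate

variable {d k : ℕ} {Ω : Set (E d)} {C β μ : ℝ} {M : Mesh Ω} {Vh : Submodule ℝ (L2 Ω (E d))}
  {Qh : Submodule ℝ (L2 Ω ℝ)} {Qt : Submodule ℝ (L2 Ω (E d))} {f u uh : L2 Ω (E d)} {p ph : L2 Ω ℝ}
  {recon : Vh →ₗ[ℝ] L2 Ω (E d)} {N : ℕ → Set (E d) → (E d → E d) → ℝ}

theorem gradField_Lp_sub (hΩ : IsOpen Ω) {v w : L2 Ω (E d)} (hv : MemH 1 Ω v) (hw : MemH 1 Ω w) :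
    gradField Ω (v - w : L2 Ω (E d)) = gradField Ω v - gradField Ω w := by
  rw [gradField_congr (Lp.coeFn_sub v w)]
  exact gradField_sub hΩ hv hw

/-- The gradient as a linear map on a space of `H^1` fields. -/
def gradLinear (hΩ : IsOpen Ω) (hV : ∀ v ∈ Vh, MemH 1 Ω v) : Vh →ₗ[ℝ] MatrixField Ω where
  toFun v := gradField Ω v.1
  map_add' v w := by
    rw [Submodule.coe_add, gradField_congr (Lp.coeFn_add v.1 w.1)]
    exact gradField_add hΩ (hV v v.2) (hV w w.2)
  map_smul' c v := by
    rw [Submodule.coe_smul, gradField_congr (Lp.coeFn_smul c v.1)]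
    exact gradField_smul hΩ c (hV v v.2)

/-- The momentum balance, tested with a divergence-free field without normal trace. -/
theorem IsSolution.inner_force (hsol : IsSolution Ω μ f u p) (hp : MemH 1 Ω p) {w : L2 Ω (E d)}
    (hdiv : divergence Ω w =ᵐ[volume.restrict Ω] 0) (hw : NormalTraceZero Ω w) :
    inner ℝ f w = -2 * μ * inner ℝ ((memLp_divStrain Ω u).toLp _) w := by
  -- The vanishing normal trace is tested with φ = p itself; this removes the pressure.
  have hp0 : ∫ x in Ω, ∑ i, w x i * weakPartial Ω i p x = 0 := by
    have h := hw p hp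
    have h0 : ∫ x in Ω, divergence Ω w x * p x = 0 := by
      refine (integral_congr_ae (hdiv.mono fun x hx => ?_)).trans (integral_zero _ _)
      simp only [hx, Pi.zero_apply, zero_mul]
    rwa [h0, add_zero] at h
  have hint1 : Integrable (fun x => -2 * μ * inner ℝ ((memLp_divStrain Ω u).toLp _ x) (w x))
      (volume.restrict Ω) := (L2.integrable_inner (𝕜 := ℝ) _ w).const_mul _
  have hint2 : Integrable (fun x => ∑ i, w x i * weakPartial Ω i p x) (volume.restrict Ω) :=
    integrable_finsetSum _ fun i _ =>
      (memLp_component (Lp.memLp w) i).integrable_mul (memLp_weakPartial Ω i p)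
  rw [L2.inner_def, L2.inner_def, ← integral_const_mul]
  refine Eq.trans ?_ (sub_zero _)
  rw [← hp0, ← integral_sub hint1 hint2]
  refine integral_congr_ae ?_
  filter_upwards [hsol.momentum, (memLp_divStrain Ω u).coeFn_toLp] with x h1 h2
  rw [h2, inner_eq_sum_component, inner_eq_sum_component, Finset.mul_sum,
    ← Finset.sum_sub_distrib]
  refine Finset.sum_congr rfl fun i _ => ?_
  rw [← h1 i]
  simp only [divStrain]
  ring

/-- The supremum need not be attained, so a strictly smaller constant is used, here β/2. A field
with zero gradient would have quotient 0 by the convention for division by zero, hence is excluded.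
-/
theorem InfSup.exists_ge (h : InfSup Vh Qh β) (hβ : 0 < β) (hΩ : IsOpen Ω)
    (hV : ∀ v ∈ Vh, MemH 1 Ω v) {q : L2 Ω ℝ} (hq : q ∈ Qh) (hq0 : q ≠ 0) :
    ∃ v ∈ Vh, gradField Ω v ≠ 0 ∧ β / 2 * ‖q‖ * ‖gradField Ω v‖ ≤
      inner ℝ q (traceField Ω (gradField Ω v)) := by
  have h1 := (le_iInf_iff.1 h) ⟨q, hq, hq0⟩
  have h2 : ((β / 2 : ℝ) : EReal) < β := EReal.coe_lt_coe_iff.2 (by linarith)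
  obtain ⟨⟨v, hv, _⟩, h3⟩ := lt_iSup_iff.1 (h2.trans_le h1)
  replace h3 := EReal.coe_lt_coe_iff.1 h3
  rw [bForm_eq_inner hΩ q (hV v hv), ← norm_gradField] at h3
  have hg : gradField Ω v ≠ 0 := by
    intro h0
    simp only [h0, norm_zero, mul_zero, div_zero] at h3
    linarith
  refine ⟨v, hv, hg, ?_⟩
  have hpos : 0 < ‖q‖ * ‖gradField Ω v‖ := mul_pos (norm_pos_iff.2 hq0) (norm_pos_iff.2 hg)
  rw [mul_assoc]
  exact ((lt_div_iff₀ hpos).1 h3).le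

/-- The right-hand side of the error estimate. -/
def meshSum (k : ℕ) (N : ℕ → Set (E d) → (E d → E d) → ℝ) (M : Mesh Ω) (u : E d → E d) : ℝ :=
  ∑ T ∈ M.elems, Metric.diam T ^ (2 * k) * N (k + 1) T u ^ 2

theorem meshSum_nonneg (k : ℕ) (N : ℕ → Set (E d) → (E d → E d) → ℝ) (M : Mesh Ω)
    (u : E d → E d) : 0 ≤ meshSum k N M u :=
  Finset.sum_nonneg fun _ _ => mul_nonneg (pow_nonneg Metric.diam_nonneg _) (sq_nonneg _)

theorem SpaceAssumption.exists_norm_gradField_sub_le [Qh.HasOrthogonalProjection]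
    [Qt.HasOrthogonalProjection] (hS : SpaceAssumption k C β N M Vh Qh Qt) (hΩ : IsOpen Ω)
    (hΩb : Bornology.IsBounded Ω) (hd : 0 < d) (hC : 0 < C) (hu : MemH (k + 1) Ω u)
    (hu0 : MemH10 Ω u) :
    ∃ v ∈ Vh, ‖gradField Ω u - gradField Ω v‖ ≤ C * √(meshSum k N M u) := by
  obtain ⟨I, hI⟩ := hS.interpolation
  obtain ⟨hIV, hIT⟩ := hI u hu hu0
  have hI1 := (hS.conforming _ hIV).1
  refine ⟨I u, hIV, ?_⟩
  have hmem : MemH 1 Ω (I u - u : L2 Ω (E d)) :=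
    (hI1.sub hu0.1).congr (Lp.coeFn_sub (I u) u).symm
  rw [norm_sub_rev, ← gradField_Lp_sub hΩ hI1 hu0.1, norm_gradField]
  refine le_of_sq_le_sq ?_ (by positivity)
  rw [mul_pow, Real.sq_sqrt (meshSum_nonneg _ _ _ _), meshSum,
    M.hSeminorm_sq_eq_sum hΩ hmem le_rfl, Finset.mul_sum]
  refine Finset.sum_le_sum fun T hT => ?_
  have hpos := M.diam_pos hd hΩb hT
  have h1 := hIT T hT 1 le_rfl
  rw [pow_one, pow_succ'] at h1
  have h2 : hNorm 1 T (I u - u : L2 Ω (E d)) ≤ C * Metric.diam T ^ k * N (k + 1) T u := by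
    refine le_of_mul_le_mul_left (h1.trans_eq ?_) hpos
    ring
  calc _ ≤ (C * Metric.diam T ^ k * N (k + 1) T u) ^ 2 :=
        pow_le_pow_left₀ (hSeminorm_nonneg _ _ _) ((hSeminorm_le_hNorm le_rfl _ _).trans h2) 2
    _ = _ := by ring

/-- The consistency error is a product of two approximation errors: k - 1 powers of h_T from
projecting q, one from the reconstruction. Cauchy–Schwarz over the elements then separates the
u-dependent sum from |e|_1. -/
theorem inner_sub_recon_le [Qh.HasOrthogonalProjection] [Qt.HasOrthogonalProjection]
    (hS : SpaceAssumption k C β N M Vh Qh Qt) (hR : ReconstructionAssumption C M Vh Qh Qt recon)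
    (hΩ : IsOpen Ω) (hC : 0 < C) (hk : 1 ≤ k) {K : ℝ} {q : L2 Ω (E d)} {u : E d → E d}
    (hq : MemH (k - 1) Ω q) (hK : 0 ≤ K) (hN : ∀ T ∈ M.elems, 0 ≤ N (k + 1) T u)
    (hqN : ∀ T ∈ M.elems, N (k - 1) T q ≤ K * N (k + 1) T u) (e : Vh) :
    inner ℝ q (e.1 - recon e) ≤ C ^ 2 * K * √(meshSum k N M u) * ‖gradField Ω e.1‖ := by
  set r : L2 Ω (E d) := Qt.starProjection q - q with hr
  set s : L2 Ω (E d) := recon e - e.1 with hs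
  have h1 : inner ℝ q (e.1 - recon e) = inner ℝ r s := by
    have h0 := hR.orthogonality e _ (Qt.starProjection_apply_mem q)
    rw [real_inner_comm] at h0
    rw [hr, hs, inner_sub_left, ← neg_sub e.1 (recon e), inner_neg_right, inner_neg_right, h0]
    ring
  have hsub : ∀ T ∈ M.elems, ∀ v : L2 Ω (E d), MemLp v 2 (volume.restrict T) := fun T hT v =>
    (Lp.memLp v).mono_measure (Measure.restrict_mono (M.subset T hT) le_rfl)
  rw [h1, L2.inner_def, M.setIntegral_eq_sum (L2.integrable_inner r s)]
  calc _ ≤ ∑ T ∈ M.elems, C ^ 2 * K * ((Metric.diam T ^ k * N (k + 1) T u) *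
        hSeminorm 1 T e.1) := by
        refine Finset.sum_le_sum fun T hT => ?_
        refine (le_abs_self _).trans
          ((abs_setIntegral_inner_le (M.isOpen T hT) (hsub T hT r) (hsub T hT s)).trans ?_)
        have hdiam : 0 ≤ Metric.diam T := Metric.diam_nonneg
        have hr' : hNorm 0 T r ≤ C * Metric.diam T ^ (k - 1) * (K * N (k + 1) T u) := by
          refine (hS.projection_Qt q hq T hT).trans ?_
          gcongr
          exact hqN T hT
        have hs' := hR.approximation e T hT 1 le_rfl
        have hNT := hN T hT
        have hpow : Metric.diam T ^ k = Metric.diam T ^ (k - 1) * Metric.diam T := by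
          rw [← pow_succ, Nat.sub_add_cancel hk]
        refine (mul_le_mul hr' hs' (hNorm_nonneg _ _ _) (by positivity)).trans_eq ?_
        rw [hpow]
        ring
    _ = C ^ 2 * K * ∑ T ∈ M.elems, (Metric.diam T ^ k * N (k + 1) T u) * hSeminorm 1 T e.1 := by
        rw [Finset.mul_sum]
    _ ≤ C ^ 2 * K * (√(∑ T ∈ M.elems, (Metric.diam T ^ k * N (k + 1) T u) ^ 2) *
        √(∑ T ∈ M.elems, hSeminorm 1 T e.1 ^ 2)) := by
        gcongr
        exact Real.sum_mul_le_sqrt_mul_sqrt _ _ _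
    _ = _ := by
        rw [← M.hSeminorm_sq_eq_sum hΩ (hS.conforming _ e.2).1 le_rfl,
          Real.sqrt_sq (hSeminorm_nonneg _ _ _), norm_gradField, meshSum, ← mul_assoc]
        simp_rw [mul_pow, ← pow_mul, mul_comm k 2]

theorem norm_gradField_error_le [FiniteDimensional ℝ Vh] [FiniteDimensional ℝ Qh]
    [Qt.HasOrthogonalProjection]
    (hS : SpaceAssumption k C β N M Vh Qh Qt) (hR : ReconstructionAssumption C M Vh Qh Qt recon)
    (hΩ : IsOpen Ω) (hΩb : Bornology.IsBounded Ω) (hd : 0 < d) (hk : 1 ≤ k) (hC : 0 < C)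
    (hβ : 0 < β) (hμ : 0 < μ) (hu : MemH (k + 1) Ω u) (hp : MemH 1 Ω p)
    (hsol : IsSolution Ω μ f u p) (hdisc : IsDiscreteSolution μ f Vh Qh recon uh ph) {K : ℝ}
    (hK : 0 ≤ K) (hN : ∀ T ∈ M.elems, 0 ≤ N (k + 1) T u)
    (hqN : ∀ T ∈ M.elems, N (k - 1) T ((memLp_divStrain Ω u).toLp _) ≤ K * N (k + 1) T u) :
    ‖gradField Ω (u - uh : L2 Ω (E d))‖ ≤
      (3 * (1 + ‖traceField Ω‖ / (β / 2)) * C + 2 * C ^ 2 * K) * √(meshSum k N M u) := by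
  have hV : ∀ v ∈ Vh, MemH 1 Ω v := fun v hv => (hS.conforming v hv).1
  have hu1 : MemH 1 Ω u := hsol.boundary.1
  set D := traceField Ω
  set X := √(meshSum k N M u)
  have hDu : ∀ q ∈ Qh, inner ℝ q (D (gradField Ω u)) = 0 := by
    intro q _
    rw [← bForm_eq_inner hΩ q hu1]
    refine (integral_congr_ae (hsol.incompressible.mono fun x hx => ?_)).trans (integral_zero _ _)
    simp only [hx, Pi.zero_apply, mul_zero]
  obtain ⟨v, hv, hvu⟩ :=
    hS.exists_norm_gradField_sub_le hΩ hΩb hd hC hu hsol.boundary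
  -- The abstract lemma is applied to the space of gradients of `V_h` with D the trace, so its norm
  -- is exactly |·|_1.
  obtain ⟨_, ⟨z, rfl⟩, hzQ, hzu⟩ := exists_discrete_kernel_approx D
    (LinearMap.range (gradLinear hΩ hV)) Qh (half_pos hβ)
    (fun q hq hq0 =>
      let ⟨w, hw, hw0, hle⟩ := hS.infSup.exists_ge hβ hΩ hV hq hq0
      ⟨gradField Ω w, ⟨⟨w, hw⟩, rfl⟩, hw0, hle⟩) hDu
    (g := gradField Ω v) ⟨⟨v, hv⟩, rfl⟩
  change ‖gradField Ω u - gradField Ω z.1‖ ≤ _ at hzu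
  change ∀ q ∈ Qh, inner ℝ q (D (gradField Ω z.1)) = 0 at hzQ
  set e : Vh := ⟨uh, hdisc.mem_Vh⟩ - z with he
  have huh1 : MemH 1 Ω uh := hV _ hdisc.mem_Vh
  have hGe : gradField Ω e.1 = gradField Ω uh - gradField Ω z.1 :=
    gradField_Lp_sub hΩ huh1 (hV _ z.2)
  have heQ : ∀ q ∈ Qh, bForm Ω q e.1 = 0 := by
    intro q hq
    have h0 := hdisc.incompressible q hq
    rw [bForm_eq_inner hΩ q huh1] at h0
    rw [bForm_eq_inner hΩ q (hV _ e.2), hGe, map_sub, inner_sub_right, hzQ q hq, h0, sub_zero]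
  set q : L2 Ω (E d) := (memLp_divStrain Ω u).toLp _ with hq
  have hqH : MemH (k - 1) Ω q := by
    have hu' : MemH (k - 1 + 2) Ω u := by rwa [show k - 1 + 2 = k + 1 by omega]
    exact hu'.divStrain.congr (memLp_divStrain Ω u).coeFn_toLp.symm
  have hcons := inner_sub_recon_le hS hR hΩ hC hk hqH hK hN hqN e
  have hforce := hsol.inner_force hp (hR.divFree e heQ) (hR.normalTrace e)
  have hmom := hdisc.momentum e
  rw [heQ ph hdisc.mem_Qh, add_zero, hforce, aForm_eq_inner] at hmom
  have hparts := (hS.conforming _ e.2).inner_symField_gradField hΩ (hu.mono (by omega))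
  have hkorn := (hS.conforming _ e.2).norm_gradField_sq_le hΩ
  set S := symField Ω
  set a := ‖gradField Ω e.1‖
  set b := ‖gradField Ω u - gradField Ω z.1‖
  -- Division by 2μ here makes the estimate independent of μ.
  have hmom' : inner ℝ (S (gradField Ω uh)) (S (gradField Ω e.1)) = -inner ℝ q (recon e) := by
    have h2μ : (2 * μ : ℝ) ≠ 0 := by positivity
    refine mul_left_cancel₀ h2μ ?_
    rw [hmom]
    ring
  have henergy : ‖S (gradField Ω e.1)‖ ^ 2 = inner ℝ q (e.1 - recon e) +
      inner ℝ (S (gradField Ω u - gradField Ω z.1)) (S (gradField Ω e.1)) := by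
    have hSe : S (gradField Ω e.1) = S (gradField Ω uh) - S (gradField Ω u) +
        S (gradField Ω u - gradField Ω z.1) := by
      rw [hGe, map_sub, map_sub]
      abel
    rw [← real_inner_self_eq_norm_sq]
    nth_rw 1 [hSe]
    rw [inner_add_left, inner_sub_left, hmom', hparts, inner_sub_right]
    ring
  have hSb : inner ℝ (S (gradField Ω u - gradField Ω z.1)) (S (gradField Ω e.1)) ≤ b * a :=
    (real_inner_le_norm _ _).trans
      (mul_le_mul (norm_symField_le _) (norm_symField_le _) (norm_nonneg _) (norm_nonneg _))
  -- Korn and the energy identity give a² ≤ 2(C²KX + b)a; one factor a is cancelled when it is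
  -- nonzero.
  have ha : a ≤ 2 * (C ^ 2 * K * X) + 2 * b := by
    rcases (norm_nonneg (gradField Ω e.1)).eq_or_lt with h0 | h0
    · rw [show a = 0 from h0.symm]
      positivity
    · refine le_of_mul_le_mul_right ?_ h0
      change a * a ≤ _ * a
      nlinarith
  have hb : b ≤ (1 + ‖D‖ / (β / 2)) * (C * X) := by
    refine hzu.trans ?_
    gcongr
  calc ‖gradField Ω (u - uh : L2 Ω (E d))‖
      = ‖(gradField Ω u - gradField Ω z.1) - gradField Ω e.1‖ := by
        rw [gradField_Lp_sub hΩ hu1 huh1, hGe]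
        congr 1
        abel
    _ ≤ b + a := norm_sub_le _ _
    -- The 3 in the constant is b from the triangle inequality plus the 2b contained in the bound
    -- for a.
    _ ≤ _ := by linarith

end ErrorEstimate

end

end MixedElasticity

/-! ### The main theorem -/

open MixedElasticity in
theorem mainTheorem1 (d k : ℕ) (hd : d = 2 ∨ d = 3) (hk : 2 ≤ k)
    (Ω : Set (E d)) (hΩo : IsOpen Ω) (hΩb : Bornology.IsBounded Ω) (hΩc : IsConnected Ω)
    (C β : ℝ) (hC : 0 < C) (hβ : 0 < β) :
    ∃ c > 0, ∀ (M : Mesh Ω)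
      (Vh : Submodule ℝ (L2 Ω (E d))) (Qh : Submodule ℝ (L2 Ω ℝ)) (Qt : Submodule ℝ (L2 Ω (E d)))
      [FiniteDimensional ℝ Vh] [FiniteDimensional ℝ Qh] [Qt.HasOrthogonalProjection]
      (recon : Vh →ₗ[ℝ] L2 Ω (E d)),
      ReconstructionAssumption C M Vh Qh Qt recon →
      ∀ (μ : ℝ), 0 < μ → ∀ (f u : L2 Ω (E d)) (p : L2 Ω ℝ) (uh : L2 Ω (E d)) (ph : L2 Ω ℝ),
      MemH (k + 1) Ω u → MemH k Ω p → IsSolution Ω μ f u p →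
      IsDiscreteSolution μ f Vh Qh recon uh ph →
      (SpaceAssumption k C β hSeminorm M Vh Qh Qt →
        hSeminorm 1 Ω (u - uh) ^ 2
            ≤ c * ∑ T ∈ M.elems, Metric.diam T ^ (2 * k) * hSeminorm (k + 1) T u ^ 2 ∧
        c * ∑ T ∈ M.elems, Metric.diam T ^ (2 * k) * hSeminorm (k + 1) T u ^ 2
            ≤ c * M.size ^ (2 * k) * hNorm (k + 1) Ω u ^ 2) ∧
      (SpaceAssumption k C β hNorm M Vh Qh Qt →
        hSeminorm 1 Ω (u - uh) ^ 2
            ≤ c * ∑ T ∈ M.elems, Metric.diam T ^ (2 * k) * hNorm (k + 1) T u ^ 2 ∧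
        c * ∑ T ∈ M.elems, Metric.diam T ^ (2 * k) * hNorm (k + 1) T u ^ 2
            ≤ c * M.size ^ (2 * k) * hNorm (k + 1) Ω u ^ 2) := by
  have hd0 : 0 < d := by omega
  obtain ⟨m, rfl⟩ : ∃ m, k = m + 1 := ⟨k - 1, by omega⟩
  -- The operator norm of the trace depends only on d and Ω, and K = 2d² is the cost of ∇·ε(u) in
  -- terms of u.
  obtain ⟨c, hc0, hc⟩ : ∃ c > 0,
      3 * (1 + ‖traceField Ω‖ / (β / 2)) * C + 2 * C ^ 2 * (2 * (d : ℝ) ^ 2) = c :=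
    ⟨_, by positivity, rfl⟩
  refine ⟨c ^ 2, by positivity, ?_⟩
  intro M Vh Qh Qt _ _ _ recon hR μ hμ f u p uh ph hu hp hsol hdisc
  have hae : ∀ T ∈ M.elems,
      (memLp_divStrain Ω u).toLp _ =ᵐ[MeasureTheory.volume.restrict T] divStrain Ω u := fun T hT =>
    ae_restrict_of_subset (M.subset T hT) (memLp_divStrain Ω u).coeFn_toLp
  -- Both cases follow from three properties of N at u: nonnegativity, control of N of ∇·ε(u) two
  -- orders higher, and domination by the full norm.
  have key : ∀ N : ℕ → Set (E d) → (E d → E d) → ℝ,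
      SpaceAssumption (m + 1) C β N M Vh Qh Qt → (∀ T ∈ M.elems, 0 ≤ N (m + 1 + 1) T u) →
      (∀ T ∈ M.elems, N m T ((memLp_divStrain Ω u).toLp _) ≤ 2 * d ^ 2 * N (m + 2) T u) →
      (∀ T ∈ M.elems, N (m + 1 + 1) T u ≤ hNorm (m + 1 + 1) T u) →
      hSeminorm 1 Ω (u - uh) ^ 2 ≤ c ^ 2 * meshSum (m + 1) N M u ∧
        c ^ 2 * meshSum (m + 1) N M u ≤
          c ^ 2 * M.size ^ (2 * (m + 1)) * hNorm (m + 1 + 1) Ω u ^ 2 := by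
    intro N hS hN0 hqN hN
    constructor
    · have h := norm_gradField_error_le hS hR hΩo hΩb hd0 (by omega) hC hβ hμ hu
        (hp.mono (by omega)) hsol hdisc (K := 2 * d ^ 2) (by positivity) hN0 hqN
      rw [hc] at h
      rw [← norm_gradField, ← Real.sq_sqrt (meshSum_nonneg (m + 1) N M u), ← mul_pow]
      exact pow_le_pow_left₀ (norm_nonneg _) h 2
    · rw [mul_assoc]
      exact mul_le_mul_of_nonneg_left (M.sum_diam_pow_mul_sq_le hΩo hu _ hN0 hN) (sq_nonneg c)
  refine ⟨fun hS => key _ hS (fun T _ => hSeminorm_nonneg _ _ _) (fun T hT => ?_)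
      fun T _ => hSeminorm_le_hNorm le_rfl _ _,
    fun hS => key _ hS (fun T _ => hNorm_nonneg _ _ _) (fun T hT => ?_) fun T _ => le_rfl⟩
  · rw [hSeminorm_congr m (hae T hT)]
    exact hu.hSeminorm_divStrain_le hΩo (M.isOpen T hT) (M.subset T hT) le_rfl
  · rw [hNorm_congr m (hae T hT)]
    exact hu.hNorm_divStrain_le hΩo (M.isOpen T hT) (M.subset T hT)
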